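/- **Setting.** Let $\mathbb W,\mathbb X=\mathbb X_1\times\mathbb X_2,\mathbb Y=\mathbb Y_1\times\mathbb Y_2$ be finite-dimensional Euclidean spaces (products carry the Euclidean norm). Let $\mathcal A:\mathbb X\to\mathbb W$ and $\mathcal B:\mathbb X\to\mathbb Y$ be linear, $b\in\mathbb Y$, $c\in\mathbb X$, let $\mathcal Q\subseteq\mathbb Y$ be a closed convex cone with polar $\mathcal Q^\circ$, let $p:\mathbb X\to(-\infty,+\infty]$ be proper closed convex, and let $h:\mathbb W\to(-\infty,+\infty]$ be proper closed convex and essentially smooth with $\nabla h$ locally Lipschitz on $\operatorname{int}(\operatorname{dom}h)$. Consider minimizing $f^0(x)=h(\mathcal Ax)+\langle c,x\rangle+p(x)$ subject to $\mathcal Bx\in b+\mathcal Q$, and the dual problem of maximizing $$g^0(w,y,s)=-h^*(w)-\langle b,y\rangle-p^*(s)$$ over the set $F_{D2}$ of all $(w,y,s)\in\operatorname{dom}h^*\times\mathcal Q^\circ\times\operatorname{dom}p^*$ with $\mathcal A^*w+\mathcal B^*y+s+c=0$. Assume: 1. $\operatorname{dom}h^*$ is open and convex, and $h^*$ is continuously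 differentiable on it with globally Lipschitz gradient, with constant $\lambda_{\nabla h^*}$. 2. $\mathcal Q=\mathcal Q_1\times\mathcal Q_2$ with $\mathcal Q_1\subseteq\mathbb Y_1$ a polyhedral cone and $\mathcal Q_2\subseteq\mathbb Y_2$ a closed convex cone with nonempty interior; $p(x)=p_1(x_1)+p_2(x_2)$ with $p_1$ proper closed convex polyhedral and $p_2$ proper closed convex with closed domain having nonempty interior; $p$ is $\lambda_p$-Lipschitz on $\operatorname{dom}p$ and $p^*$ is $\lambda_{p^*}$-Lipschitz on $\operatorname{dom}p^*$. 3. Some dual optimal solution $(\bar w,\bar y,\bar s)$ satisfies the Robinson constraint qualification $$0\in\operatorname{int}\left\{(\mathcal A^*\bar w+\mathcal B^*\bar y+\bar s+c+\mathcal A^*w+\mathcal B^*y+s,\ \bar y+y-v,\ \bar s+s-d)\ :\ w\in\mathbb W,\,y\in\mathbb Y,\,s\in\mathbb X,\,v\in\mathcal Q^\circ,\,d\in\operatorname{dom}p^*\right\}.$$ For $\sigma>0$ and $y\in\mathbb Y$, let $f_{\sigma,y}(x)=f^0(x)+\frac1{2\sigma}\left(\|\Pi_{\mathcal Q^\circ}[y+\sigma(\mathcal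 Bx-b)]\|^2-\|y\|^2\right)$ and $g_{\sigma,y}(w,y',s)=g^0(w,y',s)-\frac1{2\sigma}\|y'-y\|^2$. Call $x$ *admissible* if $x\in\operatorname{dom}p$ and $\mathcal Ax\in\operatorname{int}(\operatorname{dom}h)$; for such $x$ put $$\tilde y(x)=\Pi_{\mathcal Q^\circ}[y+\sigma(\mathcal Bx-b)],\quad \tilde w(x)=\nabla h(\mathcal Ax),\quad r(x)=x-(\mathcal A^*\tilde w(x)+\mathcal B^*\tilde y(x)+c),$$ $$\tilde s(x)=\operatorname{Prox}_{p^*}[r(x)],\quad e(x)=x-\operatorname{Prox}_p[r(x)],\quad \tilde z(x)=(\tilde w(x),\tilde y(x),\tilde s(x)).$$ For $\tau\ge0$ let $S(\tau)$ denote the condition on $(\sigma,y,x)$ $$\|e(x)\|\le\frac{\tau}{1+\|x\|+\|\tilde z(x)\|}\min\left\{\frac1{\|\nabla h^*(\tilde w(x))\|+\|\tilde y(x)-y\|/\sigma+1/\sigma},\,1\right\}.$$ Say that $\gamma\ge1$ is an *error bound constant* if, for all $w\in\operatorname{dom}h^*$, $y\in\mathcal Q^\circ$ and $s\in\operatorname{dom}p^*$,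 $$\operatorname{dist}((w,y,s),F_{D2})\le\gamma(1+\|(w,y,s)\|)\,\|\mathcal A^*w+\mathcal B^*y+s+c\|,$$ and for such $\gamma$ put $\beta=\sqrt{2[1+\lambda_p+\gamma(\|b\|+\lambda_{p^*})+\gamma^2(1+\lambda_{\nabla h^*})]}$. **Statement.** An error bound constant exists, and the following hold. (i) Let $\sigma>0$, $y\in\mathbb Y$, and let $(x^j)_{j\ge0}$ be admissible points with $f_{\sigma,y}(x^j)\to\inf f_{\sigma,y}$ and $\|e(x^j)\|\to0$. Then $(x^j)$ and $(\tilde z(x^j))$ are bounded, $(\tilde y(x^j))$ converges, and for all $j$ $$f_{\sigma,y}(x^j)-g_{\sigma,y}(\tilde z(x^j))\le(\|x^j\|+\|\tilde s(x^j)\|+\lambda_p)\,\|e(x^j)\|.$$ Moreover, if $1\ge\sup_jt_j\ge\inf_jt_j>0$, there is $\bar j$ such that for all $j\ge\bar j$ condition $S(2t_j)$ holds at $x^j$ and $f_{\sigma,y}(x^j)-\inf f_{\sigma,y}\le\beta^2t_j$ (for every error bound constant $\gamma$). (ii) For every error bound constant $\gamma$, $\sigma>0$, $y\in\mathbb Y$,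 admissible $x$ and $t\in[0,1]$: if $S(2t)$ holds at $x$, then $f_{\sigma,y}(x)-\inf f_{\sigma,y}\le\beta^2t$. (iii) Let $\gamma$, $\sigma$, $y$, $x$ be as in (ii) and $\hat\varepsilon,\hat\eta>0$. If $\hat\varepsilon^2/(2\sigma)\le1$, then (A''): $S(\hat\varepsilon^2/\sigma)$ implies (A'): $f_{\sigma,y}(x)-\inf f_{\sigma,y}\le\varepsilon^2/(2\sigma)$ with $\varepsilon=\beta\hat\varepsilon$. If $\frac{\hat\eta^2}{2\sigma}\|\tilde y(x)-y\|^2\le1$, then (B''): $S\left(\frac{\hat\eta^2}{\sigma}\|\tilde y(x)-y\|^2\right)$ implies (B'): $f_{\sigma,y}(x)-\inf f_{\sigma,y}\le\frac{\eta^2}{2\sigma}\|\tilde y(x)-y\|^2$ with $\eta=\beta\hat\eta$. (iv) Let $\gamma$ be an error bound constant, $0<\sigma_k$ nondecreasing, $y^0\in\mathcal Q^\circ$, each $x^{k+1}$ admissible, and $y^{k+1}=\Pi_{\mathcal Q^\circ}[y^k+\sigma_k(\mathcal Bx^{k+1}-b)]$ for $k\ge0$. If (A'') holds at every iteration $k$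 (that is, with $\sigma=\sigma_k$, $y=y^k$, $x=x^{k+1}$) with positive summable $\hat\varepsilon_k$, then (A') holds at every iteration with some nonnegative summable $\varepsilon_k$ such that $\varepsilon_k=\beta\hat\varepsilon_k$ for all large $k$. If in addition (B'') holds at every iteration with positive summable $\hat\eta_k$, then for all large $k$ one has $\beta\hat\eta_k<1$ and (B') holds with $\eta_k=\beta\hat\eta_k$. -/

import Mathlib

open Filter Topology
open scoped NNReal

noncomputable section

namespace ALM

section ExtendedFunctions

variable {E : Type*} [NormedAddCommGroup E] [InnerProductSpace ℝ E]

/-- Effective domain of an extended-real-valued function. -/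
def effDom (f : E → EReal) : Set E := {x | f x < ⊤}

/-- Epigraph of an extended-real-valued function. -/
def epi (f : E → EReal) : Set (E × ℝ) := {q | f q.1 ≤ (q.2 : EReal)}

/-- Proper closed convex function `E → (-∞, +∞]`. -/
structure ProperClosedConvex (f : E → EReal) : Prop where
  ne_bot : ∀ x, f x ≠ ⊥
  exists_ne_top : ∃ x, f x ≠ ⊤
  lsc : LowerSemicontinuous f
  convex_epi : Convex ℝ (epi f)

/-- Convex conjugate `f*(u) = sup_x (⟨x, u⟩ - f(x))`. -/
def conj (f : E → EReal) (u : E) : EReal := ⨆ x, (((inner ℝ x u : ℝ) : EReal) - f x)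

/-- Proximal mapping: the minimizer of `u ↦ ‖u - x‖² / 2 + f u` (it exists and is unique for a
proper closed convex `f` on a Euclidean space). -/
def prox (f : E → EReal) (x : E) : E :=
  Classical.epsilon fun u : E =>
    ∀ v, ((‖u - x‖ ^ 2 / 2 : ℝ) : EReal) + f u ≤ ((‖v - x‖ ^ 2 / 2 : ℝ) : EReal) + f v

/-- Euclidean projection: the nearest point of `D` (it exists and is unique for a nonempty closed
convex `D` in a Euclidean space). -/
def proj (D : Set E) (x : E) : E :=
  Classical.epsilon fun u : E => u ∈ D ∧ ∀ v ∈ D, ‖x - u‖ ≤ ‖x - v‖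

/-- Polar cone `D° = {y | ⟨y, d⟩ ≤ 0 for all d ∈ D}`. -/
def polar (D : Set E) : Set E := {y | ∀ d ∈ D, (inner ℝ y d : ℝ) ≤ 0}

/-- Gradient of an extended-real-valued function, meaningful in the interior of its domain. -/
def grad [FiniteDimensional ℝ E] (f : E → EReal) (x : E) : E :=
  haveI : CompleteSpace E := FiniteDimensional.complete ℝ E
  gradient (fun v => (f v).toReal) x

/-- Essential smoothness of a convex function: the interior of the domain is nonempty, the function
is differentiable there, and the norm of its gradient tends to infinity along every sequence of
interior points that converges to a boundary point. -/
structure EssentiallySmooth [FiniteDimensional ℝ E] (f : E → EReal) : Prop where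
  nonempty : (interior (effDom f)).Nonempty
  differentiableOn : DifferentiableOn ℝ (fun v => (f v).toReal) (interior (effDom f))
  blowup : ∀ (u : ℕ → E) (v : E), (∀ n, u n ∈ interior (effDom f)) → Tendsto u atTop (𝓝 v) →
    v ∈ frontier (interior (effDom f)) → Tendsto (fun n => ‖grad f (u n)‖) atTop atTop

/-- Polyhedral cone: a finite intersection of homogeneous closed half-spaces. -/
def IsPolyhedralCone (D : Set E) : Prop :=
  ∃ F : Finset E, D = {y | ∀ a ∈ F, (inner ℝ a y : ℝ) ≤ 0}

/-- Polyhedral convex function: its epigraph is a finite intersection of closed half-spaces. -/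
def IsPolyhedralFun (f : E → EReal) : Prop :=
  ∃ F : Finset (E × ℝ × ℝ),
    epi f = {q | ∀ a ∈ F, (inner ℝ a.1 q.1 : ℝ) + a.2.1 * q.2 ≤ a.2.2}

end ExtendedFunctions

/-- A convex composite conic program: minimize `h (A x) + ⟨c, x⟩ + p x` subject to `B x ∈ b + Q`. -/
structure CCCP (W X Y : Type*)
    [NormedAddCommGroup W] [InnerProductSpace ℝ W] [FiniteDimensional ℝ W]
    [NormedAddCommGroup X] [InnerProductSpace ℝ X] [FiniteDimensional ℝ X]
    [NormedAddCommGroup Y] [InnerProductSpace ℝ Y] [FiniteDimensional ℝ Y] where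
  A : X →ₗ[ℝ] W
  B : X →ₗ[ℝ] Y
  b : Y
  c : X
  /-- the closed convex cone of the constraint -/
  Q : ProperCone ℝ Y
  h : W → EReal
  p : X → EReal
  h_pcc : ProperClosedConvex h
  h_smooth : EssentiallySmooth h
  h_grad : LocallyLipschitzOn (interior (effDom h)) (grad h)
  p_pcc : ProperClosedConvex p

namespace CCCP

section General

variable {W X Y : Type*}
  [NormedAddCommGroup W] [InnerProductSpace ℝ W] [FiniteDimensional ℝ W]
  [NormedAddCommGroup X] [InnerProductSpace ℝ X] [FiniteDimensional ℝ X]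
  [NormedAddCommGroup Y] [InnerProductSpace ℝ Y] [FiniteDimensional ℝ Y]

/-- Polar cone of `Q`. -/
def Qpolar (P : CCCP W X Y) : Set Y := polar (P.Q : Set Y)

/-- Primal objective function. -/
def f0 (P : CCCP W X Y) (x : X) : EReal :=
  P.h (P.A x) + ((inner ℝ P.c x : ℝ) : EReal) + P.p x

/-- Objective function of the augmented Lagrangian subproblem:
`f0 x + (‖Π_{Q°}(y + σ (B x - b))‖² - ‖y‖²) / (2σ)`. -/
def fk (P : CCCP W X Y) (σ : ℝ) (y : Y) (x : X) : EReal :=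
  P.f0 x +
    ((1 / (2 * σ) * (‖proj P.Qpolar (y + σ • (P.B x - P.b))‖ ^ 2 - ‖y‖ ^ 2) : ℝ) : EReal)

/-- The space of the dual variables `(w, y, s)`, with the Euclidean norm. -/
abbrev DualSpace (W X Y : Type*) := WithLp 2 (W × WithLp 2 (Y × X))

/-- The point `(w, y, s)`. -/
def mkDual (w : W) (y : Y) (s : X) : DualSpace W X Y := WithLp.toLp 2 (w, WithLp.toLp 2 (y, s))

/-- The expression `A* w + B* y + s + c`. -/
def dualRes (P : CCCP W X Y) (w : W) (y : Y) (s : X) : X :=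
  LinearMap.adjoint P.A w + LinearMap.adjoint P.B y + s + P.c

/-- Dual objective function `-h*(w) - ⟨b, y⟩ - p*(s)`. -/
def g0 (P : CCCP W X Y) (z : DualSpace W X Y) : EReal :=
  -(conj P.h z.fst) - ((inner ℝ P.b z.snd.fst : ℝ) : EReal) - conj P.p z.snd.snd

/-- Dual objective function of the subproblem: `g0 (w, y', s) - ‖y' - y‖² / (2σ)`. -/
def gk (P : CCCP W X Y) (σ : ℝ) (y : Y) (z : DualSpace W X Y) : EReal :=
  P.g0 z - ((1 / (2 * σ) * ‖z.snd.fst - y‖ ^ 2 : ℝ) : EReal)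

/-- Dual feasible set. -/
def FD2 (P : CCCP W X Y) : Set (DualSpace W X Y) :=
  {z | z.fst ∈ effDom (conj P.h) ∧ P.dualRes z.fst z.snd.fst z.snd.snd = 0 ∧
    z.snd.fst ∈ P.Qpolar ∧ z.snd.snd ∈ effDom (conj P.p)}

/-- Set of dual optimal solutions. -/
def SOLD2 (P : CCCP W X Y) : Set (DualSpace W X Y) :=
  {z | z ∈ P.FD2 ∧ ∀ z' ∈ P.FD2, P.g0 z' ≤ P.g0 z}

/-- `h*` has an open convex domain and is continuously differentiable there, with a globally
`L`-Lipschitz gradient. -/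
structure Assumption1 (P : CCCP W X Y) (L : ℝ≥0) : Prop where
  isOpen : IsOpen (effDom (conj P.h))
  convex : Convex ℝ (effDom (conj P.h))
  contDiffOn : ContDiffOn ℝ 1 (fun w => (conj P.h w).toReal) (effDom (conj P.h))
  lipschitz : LipschitzOnWith L (grad (conj P.h)) (effDom (conj P.h))

/-- Robinson constraint qualification at the dual point `z = (w, y, s)` for the constraint
`(A* w + B* y + s + c, y, s) ∈ {0} × Q° × dom p*`. -/
def RCQ (P : CCCP W X Y) (z : DualSpace W X Y) : Prop :=
  (0 : X × Y × X) ∈ interior {q : X × Y × X |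
    ∃ (w : W) (y : Y) (s : X), ∃ v ∈ P.Qpolar, ∃ d ∈ effDom (conj P.p),
      q = (P.dualRes z.fst z.snd.fst z.snd.snd
            + (LinearMap.adjoint P.A w + LinearMap.adjoint P.B y + s),
          z.snd.fst + y - v,
          z.snd.snd + s - d)}

/-- Some dual optimal solution satisfies the Robinson constraint qualification. -/
def Assumption3 (P : CCCP W X Y) : Prop := ∃ z ∈ P.SOLD2, P.RCQ z

/-- The multiplier `ỹ(x) = Π_{Q°}(y + σ (B x - b))`. -/
def yt (P : CCCP W X Y) (σ : ℝ) (y : Y) (x : X) : Y := proj P.Qpolar (y + σ • (P.B x - P.b))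

/-- `w̃(x) = ∇h(A x)`. -/
def wt (P : CCCP W X Y) (x : X) : W := grad P.h (P.A x)

/-- The common argument `x - (A* w̃(x) + B* ỹ(x) + c)` of the two proximal mappings. -/
def proxArg (P : CCCP W X Y) (σ : ℝ) (y : Y) (x : X) : X :=
  x - (LinearMap.adjoint P.A (P.wt x) + LinearMap.adjoint P.B (P.yt σ y x) + P.c)

/-- `s̃(x)`, through the proximal mapping of `p*`. -/
def st (P : CCCP W X Y) (σ : ℝ) (y : Y) (x : X) : X := prox (conj P.p) (P.proxArg σ y x)

/-- The residual `e(x)`, through the proximal mapping of `p`. -/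
def ek (P : CCCP W X Y) (σ : ℝ) (y : Y) (x : X) : X := x - prox P.p (P.proxArg σ y x)

/-- `z̃(x) = (w̃(x), ỹ(x), s̃(x))`. -/
def zt (P : CCCP W X Y) (σ : ℝ) (y : Y) (x : X) : DualSpace W X Y :=
  mkDual (P.wt x) (P.yt σ y x) (P.st σ y x)

/-- The points at which the subproblem objective is finite and the residual is defined. -/
def Admissible (P : CCCP W X Y) (x : X) : Prop :=
  x ∈ effDom P.p ∧ P.A x ∈ interior (effDom P.h)

/-- `γ ≥ 1` is a constant in the global error bound for the dual feasible set. -/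
def IsErrorBound (P : CCCP W X Y) (γ : ℝ) : Prop :=
  1 ≤ γ ∧ ∀ w ∈ effDom (conj P.h), ∀ y ∈ P.Qpolar, ∀ s ∈ effDom (conj P.p),
    Metric.infDist (mkDual w y s) P.FD2 ≤ γ * (1 + ‖mkDual w y s‖) * ‖P.dualRes w y s‖

/-- The constant `β`. -/
def beta (P : CCCP W X Y) (Lh Lp Lps : ℝ≥0) (γ : ℝ) : ℝ :=
  √(2 * (1 + (Lp : ℝ) + γ * (‖P.b‖ + (Lps : ℝ)) + γ ^ 2 * (1 + (Lh : ℝ))))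

/-- The residual at `x` obeys the scaled bound with numerator `τ`:
`‖e‖ ≤ τ / (1 + ‖x‖ + ‖z̃‖) * min {1 / (‖∇h*(w̃)‖ + ‖ỹ - y‖ / σ + 1 / σ), 1}`. -/
def ScaledBound (P : CCCP W X Y) (σ : ℝ) (y : Y) (x : X) (τ : ℝ) : Prop :=
  ‖P.ek σ y x‖ ≤ τ / (1 + ‖x‖ + ‖P.zt σ y x‖) *
    min (1 / (‖grad (conj P.h) (P.wt x)‖ + ‖P.yt σ y x - y‖ / σ + 1 / σ)) 1

/-- `fk x - inf fk ≤ τ`, in the extended reals. -/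
def GapLe (P : CCCP W X Y) (σ : ℝ) (y : Y) (x : X) (τ : ℝ) : Prop :=
  P.fk σ y x ≤ (⨅ u, P.fk σ y u) + (τ : EReal)

/-- Rockafellar's criterion (A'), at one iteration. -/
def CritA' (P : CCCP W X Y) (σ : ℝ) (y : Y) (x : X) (ε : ℝ) : Prop :=
  P.GapLe σ y x (ε ^ 2 / (2 * σ))

/-- Rockafellar's criterion (B'), at one iteration. -/
def CritB' (P : CCCP W X Y) (σ : ℝ) (y : Y) (x : X) (η : ℝ) : Prop :=
  P.GapLe σ y x (η ^ 2 / (2 * σ) * ‖P.yt σ y x - y‖ ^ 2)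

/-- The implementable criterion (A''), at one iteration. -/
def CritA'' (P : CCCP W X Y) (σ : ℝ) (y : Y) (x : X) (ε : ℝ) : Prop :=
  P.ScaledBound σ y x (ε ^ 2 / σ)

/-- The implementable criterion (B''), at one iteration. -/
def CritB'' (P : CCCP W X Y) (σ : ℝ) (y : Y) (x : X) (η : ℝ) : Prop :=
  P.ScaledBound σ y x (η ^ 2 / σ * ‖P.yt σ y x - y‖ ^ 2)

/-- `(x, y)` is generated by the augmented Lagrangian method with penalty parameters `σ`, the
accuracy of the subproblem solutions being left open. -/
structure IsALMSequence (P : CCCP W X Y) (σ : ℕ → ℝ) (x : ℕ → X) (y : ℕ → Y) : Prop where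
  sigma_pos : ∀ k, 0 < σ k
  sigma_mono : Monotone σ
  init : y 0 ∈ P.Qpolar
  admissible : ∀ k, P.Admissible (x (k + 1))
  update : ∀ k, y (k + 1) = P.yt (σ k) (y k) (x (k + 1))

end General

section Split

variable {W X₁ X₂ Y₁ Y₂ : Type*}
  [NormedAddCommGroup W] [InnerProductSpace ℝ W] [FiniteDimensional ℝ W]
  [NormedAddCommGroup X₁] [InnerProductSpace ℝ X₁] [FiniteDimensional ℝ X₁]
  [NormedAddCommGroup X₂] [InnerProductSpace ℝ X₂] [FiniteDimensional ℝ X₂]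
  [NormedAddCommGroup Y₁] [InnerProductSpace ℝ Y₁] [FiniteDimensional ℝ Y₁]
  [NormedAddCommGroup Y₂] [InnerProductSpace ℝ Y₂] [FiniteDimensional ℝ Y₂]

/-- `Q = Q₁ × Q₂` with `Q₁` polyhedral and `Q₂` with nonempty interior; `p = p₁ + p₂` with `p₁`
polyhedral and `dom p₂` closed with nonempty interior; `p` is `Lp`-Lipschitz on its domain and
`p*` is `Lps`-Lipschitz on its domain. The parts with index 2 may be polyhedral as well. -/
structure Assumption2 (P : CCCP W (WithLp 2 (X₁ × X₂)) (WithLp 2 (Y₁ × Y₂)))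
    (Lp Lps : ℝ≥0) : Prop where
  cone_split : ∃ (Q₁ : ProperCone ℝ Y₁) (Q₂ : ProperCone ℝ Y₂),
    (∀ y, y ∈ P.Q ↔ y.fst ∈ Q₁ ∧ y.snd ∈ Q₂) ∧
    IsPolyhedralCone (Q₁ : Set Y₁) ∧ (interior (Q₂ : Set Y₂)).Nonempty
  fun_split : ∃ (p₁ : X₁ → EReal) (p₂ : X₂ → EReal),
    (∀ x, P.p x = p₁ x.fst + p₂ x.snd) ∧
    ProperClosedConvex p₁ ∧ IsPolyhedralFun p₁ ∧
    ProperClosedConvex p₂ ∧ IsClosed (effDom p₂) ∧ (interior (effDom p₂)).Nonempty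
  lipschitz : LipschitzOnWith Lp (fun x => (P.p x).toReal) (effDom P.p)
  lipschitz_conj : LipschitzOnWith Lps (fun s => (conj P.p s).toReal) (effDom (conj P.p))

end Split

end CCCP

end ALM

end

/-!
The dual feasible set is the zero set of the affine map `z = (w, y, s) ↦ A* w + B* y + s + c` on the
convex set `dom h* × Q° × dom p*`. The Robinson constraint qualification, together with openness of
`dom h*`, makes a ball around the origin the image of a bounded part of this set
(`exists_resid_hull`). Two consequences follow. A point `z` with residual `r` becomes feasible after
a step of relative length `‖r‖ / (ρ + ‖r‖)` toward a bounded point with residual `-ρ r / ‖r‖`, which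
is the global error bound (`exists_isErrorBound`); and weak duality, used at finitely many points
whose residuals surround the origin, makes the subproblem objective coercive
(`exists_mul_norm_le_fkReal`).

At an admissible `x` the candidate `z̃(x)` has residual exactly `e(x)`, by Moreau's decomposition,
and the Fenchel equalities for `h`, `p` and the projection reduce the gap between `f(x)` and
`g(z̃(x))` to `⟨x - s̃, e⟩ + p(x) - p(x - e)` (`fkReal_le_gkReal_zt`). The error bound then gives
feasible points near `z̃(x)`, and the sensitivity of the dual objective, quadratic in `w` and `y` and
Lipschitz in `s`, bounds the loss; the scaled residual bound is designed so that the total is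
`β² t` (`exists_feasible_of_scaledBound`). Weak duality turns this into a bound on
`f(x) - inf f`.

For a minimizing sequence with vanishing residuals, coercivity bounds `x`, and `w̃ = ∇h(A x)` is
bounded because `A* w̃ + s̃` is, with `s̃` a subgradient of `p` near `x` and `h` bounded around
`A x₀` for one admissible `x₀` (`exists_norm_wt_le`); the multipliers `ỹ` form a Cauchy sequence
since the augmented term is uniformly midpoint convex with respect to them (`exists_midpoint_le`).
Along the outer iteration, the same nearby feasible points are nearly optimal for the strongly
concave regularized dual, hence no farther from a dual solution than the previous iterate up to a
summable error (`norm_sub_dual_solution_le`). So the multipliers stay bounded and the restrictions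
`t ≤ 1` hold for all large `k`.
-/

namespace ALM

section ExtendedFunctions

/-! ### Convex functions and their conjugates, in real terms -/

variable {E : Type*} {f : E → EReal} {x u : E}

lemma coe_toReal_of_mem_effDom (hf : ∀ x, f x ≠ ⊥) (hx : x ∈ effDom f) :
    ((f x).toReal : EReal) = f x :=
  EReal.coe_toReal (ne_of_lt hx) (hf x)

lemma eq_top_of_notMem_effDom (hx : x ∉ effDom f) : f x = ⊤ :=
  not_lt_top_iff.mp hx

variable [NormedAddCommGroup E] [InnerProductSpace ℝ E]

lemma ProperClosedConvex.nonempty_effDom (hf : ProperClosedConvex f) : (effDom f).Nonempty :=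
  hf.exists_ne_top.imp fun _ hx => lt_top_iff_ne_top.mpr hx

lemma conj_ne_bot (hf : ∀ x, f x ≠ ⊥) (hne : (effDom f).Nonempty) (u : E) : conj f u ≠ ⊥ := by
  obtain ⟨x, hx⟩ := hne
  have h : ((inner ℝ x u : ℝ) : EReal) - f x ≤ conj f u :=
    le_iSup (fun x => ((inner ℝ x u : ℝ) : EReal) - f x) x
  rw [← coe_toReal_of_mem_effDom hf hx, ← EReal.coe_sub] at h
  exact fun hb => EReal.coe_ne_bot _ (le_bot_iff.mp (hb ▸ h))

/-- Fenchel–Young inequality. -/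
lemma inner_le_toReal_add_toReal_conj (hf : ∀ x, f x ≠ ⊥) (hx : x ∈ effDom f)
    (hu : u ∈ effDom (conj f)) : (inner ℝ x u : ℝ) ≤ (f x).toReal + (conj f u).toReal := by
  have h : ((inner ℝ x u : ℝ) : EReal) - f x ≤ conj f u :=
    le_iSup (fun x => ((inner ℝ x u : ℝ) : EReal) - f x) x
  rw [← coe_toReal_of_mem_effDom hf hx, ← EReal.coe_sub,
    ← coe_toReal_of_mem_effDom (conj_ne_bot hf ⟨x, hx⟩) hu, EReal.coe_le_coe_iff] at h
  linarith

lemma conj_le_coe {r : ℝ} (hf : ∀ x, f x ≠ ⊥)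
    (h : ∀ x ∈ effDom f, (inner ℝ x u : ℝ) - (f x).toReal ≤ r) : conj f u ≤ r := by
  refine iSup_le fun x => ?_
  by_cases hx : x ∈ effDom f
  · rw [← coe_toReal_of_mem_effDom hf hx, ← EReal.coe_sub, EReal.coe_le_coe_iff]
    exact h x hx
  · rw [eq_top_of_notMem_effDom hx]
    simp

lemma mem_effDom_conj {r : ℝ} (hf : ∀ x, f x ≠ ⊥)
    (h : ∀ x ∈ effDom f, (inner ℝ x u : ℝ) - (f x).toReal ≤ r) : u ∈ effDom (conj f) :=
  (conj_le_coe hf h).trans_lt (EReal.coe_lt_top r)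

lemma toReal_conj_le {r : ℝ} (hf : ∀ x, f x ≠ ⊥) (hne : (effDom f).Nonempty)
    (h : ∀ x ∈ effDom f, (inner ℝ x u : ℝ) - (f x).toReal ≤ r) : (conj f u).toReal ≤ r := by
  have h1 := conj_le_coe hf h
  rwa [← coe_toReal_of_mem_effDom (conj_ne_bot hf hne) (mem_effDom_conj hf h),
    EReal.coe_le_coe_iff] at h1

/-- A subgradient of `f` at `x` lies in the domain of the conjugate and attains equality in the
Fenchel–Young inequality. -/
lemma conj_of_subgradient (hf : ∀ x, f x ≠ ⊥) (hx : x ∈ effDom f)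
    (h : ∀ v ∈ effDom f, (f x).toReal + (inner ℝ (v - x) u : ℝ) ≤ (f v).toReal) :
    u ∈ effDom (conj f) ∧ (f x).toReal + (conj f u).toReal = (inner ℝ x u : ℝ) := by
  have h1 : ∀ v ∈ effDom f,
      (inner ℝ v u : ℝ) - (f v).toReal ≤ (inner ℝ x u : ℝ) - (f x).toReal := by
    intro v hv
    have := h v hv
    rw [inner_sub_left] at this
    linarith
  refine ⟨mem_effDom_conj hf h1, le_antisymm ?_ ?_⟩
  · have := toReal_conj_le hf ⟨x, hx⟩ h1
    linarith
  · exact inner_le_toReal_add_toReal_conj hf hx (mem_effDom_conj hf h1)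

lemma convexOn_toReal (hf : ProperClosedConvex f) :
    ConvexOn ℝ (effDom f) fun x => (f x).toReal := by
  have key : ∀ ⦃x⦄, x ∈ effDom f → ∀ ⦃y⦄, y ∈ effDom f → ∀ ⦃a b : ℝ⦄, 0 ≤ a → 0 ≤ b →
      a + b = 1 → f (a • x + b • y) ≤ ((a * (f x).toReal + b * (f y).toReal : ℝ) : EReal) := by
    intro x hx y hy a b ha hb hab
    have hx' : (x, (f x).toReal) ∈ epi f := (coe_toReal_of_mem_effDom hf.ne_bot hx).ge
    have hy' : (y, (f y).toReal) ∈ epi f := (coe_toReal_of_mem_effDom hf.ne_bot hy).ge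
    exact hf.convex_epi hx' hy' ha hb hab
  have hdom : Convex ℝ (effDom f) := fun x hx y hy a b ha hb hab =>
    (key hx hy ha hb hab).trans_lt (EReal.coe_lt_top _)
  refine ⟨hdom, fun x hx y hy a b ha hb hab => ?_⟩
  have := key hx hy ha hb hab
  rw [← coe_toReal_of_mem_effDom hf.ne_bot (hdom hx hy ha hb hab), EReal.coe_le_coe_iff] at this
  simpa using this

lemma convexOn_toReal_conj (hf : ∀ x, f x ≠ ⊥) (hne : (effDom f).Nonempty) :
    ConvexOn ℝ (effDom (conj f)) fun u => (conj f u).toReal := by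
  have key : ∀ ⦃u⦄, u ∈ effDom (conj f) → ∀ ⦃v⦄, v ∈ effDom (conj f) → ∀ ⦃a b : ℝ⦄, 0 ≤ a →
      0 ≤ b → a + b = 1 → ∀ x ∈ effDom f, (inner ℝ x (a • u + b • v) : ℝ) - (f x).toReal ≤
        a * (conj f u).toReal + b * (conj f v).toReal := by
    intro u hu v hv a b ha hb hab x hx
    have h1 := mul_le_mul_of_nonneg_left (inner_le_toReal_add_toReal_conj hf hx hu) ha
    have h2 := mul_le_mul_of_nonneg_left (inner_le_toReal_add_toReal_conj hf hx hv) hb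
    rw [inner_add_right, inner_smul_right, inner_smul_right]
    have h3 : (f x).toReal = a * (f x).toReal + b * (f x).toReal := by rw [← add_mul, hab, one_mul]
    linarith
  refine ⟨fun u hu v hv a b ha hb hab => mem_effDom_conj hf (key hu hv ha hb hab),
    fun u hu v hv a b ha hb hab => ?_⟩
  simpa using toReal_conj_le hf hne (key hu hv ha hb hab)

/-! ### Gradients -/

/-- Gradient inequality for a convex function. -/
lemma add_inner_gradient_le [CompleteSpace E] {s : Set E} {φ : E → ℝ} {g v : E}
    (hφ : ConvexOn ℝ s φ) (hx : x ∈ s) (hv : v ∈ s) (hg : HasGradientAt φ g x) :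
    φ x + (inner ℝ (v - x) g : ℝ) ≤ φ v := by
  have hl : HasDerivAt (fun t : ℝ => φ (AffineMap.lineMap x v t)) (inner ℝ g (v - x) : ℝ) 0 := by
    have h1 : HasFDerivAt φ (InnerProductSpace.toDual ℝ E g) (AffineMap.lineMap x v (0 : ℝ)) := by
      simpa using hg.hasFDerivAt
    have h2 := h1.comp_hasDerivAt (0 : ℝ) AffineMap.hasDerivAt_lineMap
    simpa [Function.comp_def] using h2
  have hc : ConvexOn ℝ (Set.Icc (0 : ℝ) 1) (fun t : ℝ => φ (AffineMap.lineMap x v t)) := by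
    refine (hφ.comp_affineMap (AffineMap.lineMap x v)).subset ?_ (convex_Icc 0 1)
    intro t ht
    exact hφ.1.segment_subset hx hv (segment_eq_image_lineMap ℝ x v ▸ Set.mem_image_of_mem _ ht)
  have := hc.le_slope_of_hasDerivAt (x := 0) (y := 1) (by simp) (by simp) one_pos hl
  simp only [slope_def_field, AffineMap.lineMap_apply_one, AffineMap.lineMap_apply_zero, sub_zero,
    div_one] at this
  rw [real_inner_comm]
  linarith

/-- Descent lemma: a function with `L`-Lipschitz gradient on a convex set lies below its quadratic
upper model. -/
lemma le_add_inner_gradient_add_sq [CompleteSpace E] {s : Set E} {φ : E → ℝ} {g : E → E} {L : ℝ≥0}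
    {v : E} (hs : Convex ℝ s) (hg : ∀ z ∈ s, HasGradientAt φ (g z) z) (hL : LipschitzOnWith L g s)
    (hx : x ∈ s) (hv : v ∈ s) :
    φ v ≤ φ x + (inner ℝ (g x) (v - x) : ℝ) + L / 2 * ‖v - x‖ ^ 2 := by
  have hmem : ∀ t ∈ Set.Icc (0 : ℝ) 1, AffineMap.lineMap x v t ∈ s := fun t ht =>
    hs.segment_subset hx hv (segment_eq_image_lineMap ℝ x v ▸ Set.mem_image_of_mem _ ht)
  have hl : ∀ t ∈ Set.Icc (0 : ℝ) 1, HasDerivAt (fun t : ℝ => φ (AffineMap.lineMap x v t))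
      (inner ℝ (g (AffineMap.lineMap x v t)) (v - x) : ℝ) t := by
    intro t ht
    have h2 := (hg _ (hmem t ht)).hasFDerivAt.comp_hasDerivAt t AffineMap.hasDerivAt_lineMap
    simpa [Function.comp_def] using h2
  have hB : ∀ t : ℝ, HasDerivAt
      (fun t : ℝ => φ x + t * (inner ℝ (g x) (v - x) : ℝ) + L / 2 * ‖v - x‖ ^ 2 * t ^ 2)
      ((inner ℝ (g x) (v - x) : ℝ) + L * ‖v - x‖ ^ 2 * t) t := by
    intro t
    have h := (((hasDerivAt_id' t).mul_const (inner ℝ (g x) (v - x) : ℝ)).const_add (φ x)).add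
      (((hasDerivAt_id' t).pow 2).const_mul (L / 2 * ‖v - x‖ ^ 2))
    refine HasDerivAt.congr_deriv h ?_
    push_cast
    ring
  have := image_le_of_deriv_right_le_deriv_boundary (a := (0 : ℝ)) (b := 1)
    (f := fun t : ℝ => φ (AffineMap.lineMap x v t))
    (f' := fun t => (inner ℝ (g (AffineMap.lineMap x v t)) (v - x) : ℝ))
    (B := fun t : ℝ => φ x + t * (inner ℝ (g x) (v - x) : ℝ) + L / 2 * ‖v - x‖ ^ 2 * t ^ 2)
    (B' := fun t => (inner ℝ (g x) (v - x) : ℝ) + L * ‖v - x‖ ^ 2 * t)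
    (fun t ht => (hl t ht).continuousAt.continuousWithinAt)
    (fun t ht => (hl t (Set.Ico_subset_Icc_self ht)).hasDerivWithinAt) (by simp)
    (fun t _ => (hB t).continuousAt.continuousWithinAt)
    (fun t _ => (hB t).hasDerivWithinAt) ?_ (x := 1) (by simp)
  · simpa using this
  · intro t ht
    have h1 : ‖g (AffineMap.lineMap x v t) - g x‖ ≤ L * (t * ‖v - x‖) := by
      have h := hL.dist_le_mul _ (hmem t (Set.Ico_subset_Icc_self ht)) _ hx
      rwa [dist_eq_norm, dist_lineMap_left, Real.norm_of_nonneg ht.1, dist_comm, dist_eq_norm] at h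
    have h2 := real_inner_le_norm (g (AffineMap.lineMap x v t) - g x) (v - x)
    rw [inner_sub_left] at h2
    have h3 := mul_le_mul_of_nonneg_right h1 (norm_nonneg (v - x))
    linarith

lemma hasGradientAt_grad [FiniteDimensional ℝ E] [CompleteSpace E]
    (h : DifferentiableAt ℝ (fun v => (f v).toReal) x) :
    HasGradientAt (fun v => (f v).toReal) (grad f x) x :=
  h.hasGradientAt

/-! ### Proximal mappings and projections -/

/-- A proper lower semicontinuous function with an affine minorant has proximal points: the
proximal objective is coercive. -/
lemma prox_spec [FiniteDimensional ℝ E] (hf : ∀ x, f x ≠ ⊥) (hne : (effDom f).Nonempty)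
    (hlsc : LowerSemicontinuous f) (hc : (effDom (conj f)).Nonempty) (r : E) :
    ∀ v, ((‖prox f r - r‖ ^ 2 / 2 : ℝ) : EReal) + f (prox f r) ≤
      ((‖v - r‖ ^ 2 / 2 : ℝ) : EReal) + f v := by
  refine Classical.epsilon_spec (p := fun u : E =>
    ∀ v, ((‖u - r‖ ^ 2 / 2 : ℝ) : EReal) + f u ≤ ((‖v - r‖ ^ 2 / 2 : ℝ) : EReal) + f v) ?_
  obtain ⟨u₀, hu₀⟩ := hne
  obtain ⟨s, hs⟩ := hc
  set F : E → EReal := fun v => ((‖v - r‖ ^ 2 / 2 : ℝ) : EReal) + f v with hF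
  have hFlsc : LowerSemicontinuous F := by
    refine LowerSemicontinuous.add' ?_ hlsc fun v => EReal.continuousAt_add ?_ ?_
    · exact Continuous.lowerSemicontinuous
        (continuous_coe_real_ereal.comp (f := fun v : E => ‖v - r‖ ^ 2 / 2) (by fun_prop))
    · exact Or.inl (EReal.coe_ne_top _)
    · exact Or.inl (EReal.coe_ne_bot _)
  set m : ℝ := ‖u₀ - r‖ ^ 2 / 2 + (f u₀).toReal with hm
  set K : ℝ := m + (conj f s).toReal - inner ℝ r s with hK
  set R : ℝ := 2 * ‖s‖ + 2 + 2 * |K| + ‖u₀ - r‖ with hR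
  have hu₀R : u₀ ∈ Metric.closedBall r R := by
    rw [Metric.mem_closedBall, dist_eq_norm, hR]
    have := norm_nonneg s
    have := abs_nonneg K
    linarith
  obtain ⟨u, -, hu⟩ := LowerSemicontinuousOn.exists_isMinOn ⟨u₀, hu₀R⟩
    (isCompact_closedBall r R) (hFlsc.lowerSemicontinuousOn _)
  refine ⟨u, fun v => ?_⟩
  change F u ≤ F v
  by_cases hvR : v ∈ Metric.closedBall r R
  · exact hu hvR
  refine (hu hu₀R).trans ?_
  by_cases hv : v ∈ effDom f
  swap
  · simp [hF, eq_top_of_notMem_effDom hv]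
  simp only [hF]
  rw [← coe_toReal_of_mem_effDom hf hv, ← coe_toReal_of_mem_effDom hf hu₀, ← EReal.coe_add,
    ← EReal.coe_add, EReal.coe_le_coe_iff]
  have h1 := inner_le_toReal_add_toReal_conj hf hv hs
  have h2 : -(‖v - r‖ * ‖s‖) ≤ (inner ℝ (v - r) s : ℝ) :=
    neg_le_of_abs_le (abs_real_inner_le_norm _ _)
  rw [inner_sub_left] at h2
  rw [Metric.mem_closedBall, dist_eq_norm, not_le] at hvR
  have h3 : 1 + |K| ≤ ‖v - r‖ / 2 - ‖s‖ := by
    have := norm_nonneg (u₀ - r)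
    linarith
  have h4 : 1 ≤ ‖v - r‖ := by
    have := norm_nonneg (u₀ - r)
    have := norm_nonneg s
    have := abs_nonneg K
    linarith
  have h5 : K ≤ ‖v - r‖ * (‖v - r‖ / 2 - ‖s‖) := by
    have := le_abs_self K
    have h0 : 0 ≤ ‖v - r‖ / 2 - ‖s‖ := by linarith [abs_nonneg K]
    nlinarith
  nlinarith

/-- `r - prox_f r` is a subgradient of `f` at `prox_f r`. -/
lemma prox_subgradient [FiniteDimensional ℝ E] (hf : ProperClosedConvex f)
    (hc : (effDom (conj f)).Nonempty) (r : E) :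
    prox f r ∈ effDom f ∧ ∀ v ∈ effDom f, (f (prox f r)).toReal +
      (inner ℝ (v - prox f r) (r - prox f r) : ℝ) ≤ (f v).toReal := by
  have hspec := prox_spec hf.ne_bot hf.nonempty_effDom hf.lsc hc r
  set u := prox f r with hu
  have hudom : u ∈ effDom f := by
    obtain ⟨v, hv⟩ := hf.nonempty_effDom
    by_contra hcon
    have := hspec v
    rw [eq_top_of_notMem_effDom hcon, ← coe_toReal_of_mem_effDom hf.ne_bot hv, ← EReal.coe_add,
      EReal.coe_add_top, top_le_iff] at this
    exact EReal.coe_ne_top _ this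
  refine ⟨hudom, fun v hv => ?_⟩
  have hconv := convexOn_toReal hf
  -- compare `u` with `u + t (v - u)` and let `t → 0`
  have key : ∀ t ∈ Set.Ioo (0 : ℝ) 1, (f u).toReal + (inner ℝ (v - u) (r - u) : ℝ) ≤
      (f v).toReal + t * (‖v - u‖ ^ 2 / 2) := by
    intro t ht
    have h1 : (1 - t) • u + t • v ∈ effDom f :=
      hconv.1 hudom hv (by linarith [ht.2]) ht.1.le (by ring)
    have h2 := hconv.2 hudom hv (show 0 ≤ 1 - t by linarith [ht.2]) ht.1.le (by ring)
    have h3 := hspec ((1 - t) • u + t • v)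
    rw [← coe_toReal_of_mem_effDom hf.ne_bot hudom, ← coe_toReal_of_mem_effDom hf.ne_bot h1,
      ← EReal.coe_add, ← EReal.coe_add, EReal.coe_le_coe_iff] at h3
    have h4 : (1 - t) • u + t • v - r = (u - r) + t • (v - u) := by module
    have h5 : ‖(1 - t) • u + t • v - r‖ ^ 2 =
        ‖u - r‖ ^ 2 - 2 * t * (inner ℝ (v - u) (r - u) : ℝ) + t ^ 2 * ‖v - u‖ ^ 2 := by
      rw [h4, norm_add_sq_real, norm_smul, inner_smul_right, real_inner_comm, mul_pow,
        Real.norm_eq_abs, sq_abs, ← neg_sub r u, inner_neg_right, norm_neg]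
      ring
    simp only [smul_eq_mul] at h2
    rw [h5] at h3
    have h6 : t * ((f u).toReal + (inner ℝ (v - u) (r - u) : ℝ)) ≤
        t * ((f v).toReal + t * (‖v - u‖ ^ 2 / 2)) := by nlinarith
    exact le_of_mul_le_mul_left h6 ht.1
  have hlim : Tendsto (fun t : ℝ => (f v).toReal + t * (‖v - u‖ ^ 2 / 2)) (𝓝[>] 0)
      (𝓝 ((f v).toReal + 0 * (‖v - u‖ ^ 2 / 2))) :=
    tendsto_nhdsWithin_of_tendsto_nhds (Continuous.tendsto (by fun_prop) 0)
  have := ge_of_tendsto hlim (mem_of_superset (Ioo_mem_nhdsGT one_pos) key)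
  simpa using this

/-- Moreau decomposition: `prox_{f*} r = r - prox_f r`. -/
lemma prox_conj [FiniteDimensional ℝ E] (hf : ProperClosedConvex f)
    (hc : (effDom (conj f)).Nonempty) (r : E) : prox (conj f) r = r - prox f r := by
  obtain ⟨hudom, hsub⟩ := prox_subgradient hf hc r
  set u := prox f r with hu
  obtain ⟨hs, heq⟩ := conj_of_subgradient hf.ne_bot hudom hsub
  have hcb := conj_ne_bot hf.ne_bot hf.nonempty_effDom
  -- `r - u` minimizes the strongly convex proximal objective of `f*`
  have key : ∀ v ∈ effDom (conj f), ‖(r - u) - r‖ ^ 2 / 2 + (conj f (r - u)).toReal +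
      ‖v - (r - u)‖ ^ 2 / 2 ≤ ‖v - r‖ ^ 2 / 2 + (conj f v).toReal := by
    intro v hv
    have h1 := inner_le_toReal_add_toReal_conj hf.ne_bot hudom hv
    have h2 : ‖v - r‖ ^ 2 = ‖v - (r - u)‖ ^ 2 - 2 * (inner ℝ u (v - (r - u)) : ℝ) + ‖u‖ ^ 2 := by
      rw [show v - r = (v - (r - u)) - u by abel, norm_sub_sq_real, real_inner_comm]
    have h3 : ‖(r - u) - r‖ = ‖u‖ := by rw [show (r - u) - r = -u by abel, norm_neg]
    rw [h2, h3]
    rw [inner_sub_right]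
    linarith
  have hspec : ∀ v, ((‖prox (conj f) r - r‖ ^ 2 / 2 : ℝ) : EReal) + conj f (prox (conj f) r) ≤
      ((‖v - r‖ ^ 2 / 2 : ℝ) : EReal) + conj f v := by
    refine Classical.epsilon_spec (p := fun w : E => ∀ v, ((‖w - r‖ ^ 2 / 2 : ℝ) : EReal) +
      conj f w ≤ ((‖v - r‖ ^ 2 / 2 : ℝ) : EReal) + conj f v) ⟨r - u, fun v => ?_⟩
    by_cases hv : v ∈ effDom (conj f)
    · rw [← coe_toReal_of_mem_effDom hcb hv, ← coe_toReal_of_mem_effDom hcb hs, ← EReal.coe_add,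
        ← EReal.coe_add, EReal.coe_le_coe_iff]
      have := key v hv
      have := sq_nonneg ‖v - (r - u)‖
      linarith
    · rw [eq_top_of_notMem_effDom hv]
      simp
  set v := prox (conj f) r with hvdef
  have h1 := hspec (r - u)
  have hv : v ∈ effDom (conj f) := by
    by_contra hcon
    rw [eq_top_of_notMem_effDom hcon, ← coe_toReal_of_mem_effDom hcb hs, ← EReal.coe_add,
      EReal.coe_add_top, top_le_iff] at h1
    exact EReal.coe_ne_top _ h1
  rw [← coe_toReal_of_mem_effDom hcb hv, ← coe_toReal_of_mem_effDom hcb hs, ← EReal.coe_add,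
    ← EReal.coe_add, EReal.coe_le_coe_iff] at h1
  have h2 := key v hv
  have h3 : ‖v - (r - u)‖ ^ 2 ≤ 0 := by linarith
  have h4 : ‖v - (r - u)‖ = 0 := by
    have := norm_nonneg (v - (r - u))
    nlinarith
  exact sub_eq_zero.mp (norm_eq_zero.mp h4)

lemma zero_mem_polar (D : Set E) : (0 : E) ∈ polar D := fun d _ => by simp

lemma add_mem_polar {D : Set E} {a b : E} (ha : a ∈ polar D) (hb : b ∈ polar D) :
    a + b ∈ polar D := fun d hd => by
  rw [inner_add_left]
  linarith [ha d hd, hb d hd]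

lemma smul_mem_polar {D : Set E} {a : E} {t : ℝ} (ht : 0 ≤ t) (ha : a ∈ polar D) :
    t • a ∈ polar D := fun d hd => by
  rw [real_inner_smul_left]
  exact mul_nonpos_of_nonneg_of_nonpos ht (ha d hd)

lemma convex_polar (D : Set E) : Convex ℝ (polar D) := fun _ hx _ hy _ _ ha hb _ =>
  add_mem_polar (smul_mem_polar ha hx) (smul_mem_polar hb hy)

lemma isClosed_polar (D : Set E) : IsClosed (polar D) := by
  have : polar D = ⋂ d ∈ D, {y | (inner ℝ y d : ℝ) ≤ 0} := by
    ext y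
    simp [polar]
  rw [this]
  exact isClosed_biInter fun d _ => isClosed_le (by fun_prop) continuous_const

/-- The projection `u` of `v` on a polar cone is characterized by `⟨v - u, u⟩ = 0` and
`⟨v - u, k⟩ ≤ 0` for all `k` in the cone. -/
lemma proj_polar_spec [CompleteSpace E] (D : Set E) (v : E) : proj (polar D) v ∈ polar D ∧
    (inner ℝ (v - proj (polar D) v) (proj (polar D) v) : ℝ) = 0 ∧
    ∀ k ∈ polar D, (inner ℝ (v - proj (polar D) v) k : ℝ) ≤ 0 := by
  have hspec : proj (polar D) v ∈ polar D ∧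
      ∀ k ∈ polar D, ‖v - proj (polar D) v‖ ≤ ‖v - k‖ := by
    refine Classical.epsilon_spec
      (p := fun u : E => u ∈ polar D ∧ ∀ k ∈ polar D, ‖v - u‖ ≤ ‖v - k‖) ?_
    obtain ⟨u, hu, he⟩ := exists_norm_eq_iInf_of_complete_convex ⟨0, zero_mem_polar D⟩
      (isClosed_polar D).isComplete (convex_polar D) v
    exact ⟨u, hu, fun k hk => he.le.trans (ciInf_le (f := fun w : polar D => ‖v - w‖)
      ⟨0, by rintro _ ⟨w, rfl⟩; exact norm_nonneg _⟩ ⟨k, hk⟩)⟩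
  obtain ⟨hu, hmin⟩ := hspec
  set u := proj (polar D) v
  have hne : Nonempty (polar D) := ⟨⟨u, hu⟩⟩
  have hobt := (norm_eq_iInf_iff_real_inner_le_zero (convex_polar D) hu).mp
    (le_antisymm (le_ciInf fun k => hmin k k.2) (ciInf_le (f := fun w : polar D => ‖v - w‖)
      ⟨0, by rintro _ ⟨w, rfl⟩; exact norm_nonneg _⟩ ⟨u, hu⟩))
  have h0 := hobt 0 (zero_mem_polar D)
  have h2 := hobt (u + u) (add_mem_polar hu hu)
  rw [zero_sub, inner_neg_right] at h0
  rw [add_sub_cancel_right] at h2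
  refine ⟨hu, by linarith, fun k hk => ?_⟩
  have h3 := hobt (u + k) (add_mem_polar hu hk)
  rwa [add_sub_cancel_left] at h3

lemma norm_proj_polar_le [CompleteSpace E] (D : Set E) (v : E) : ‖proj (polar D) v‖ ≤ ‖v‖ := by
  obtain ⟨-, h0, -⟩ := proj_polar_spec D v
  set u := proj (polar D) v
  rw [inner_sub_left, real_inner_self_eq_norm_sq, sub_eq_zero] at h0
  have := real_inner_le_norm v u
  rcases (norm_nonneg u).eq_or_lt with h | h
  · rw [← h]
    exact norm_nonneg v
  · nlinarith

/-- `‖Π v‖²/2` is the maximum over the cone of `k ↦ ⟨v, k⟩ - ‖k‖²/2`. -/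
lemma two_inner_sub_sq_le_norm_proj_sq [CompleteSpace E] {D : Set E} (v : E) {k : E}
    (hk : k ∈ polar D) : 2 * (inner ℝ v k : ℝ) - ‖k‖ ^ 2 ≤ ‖proj (polar D) v‖ ^ 2 := by
  obtain ⟨-, -, h⟩ := proj_polar_spec D v
  have h1 := h k hk
  have h2 := norm_sub_sq_real (proj (polar D) v) k
  rw [inner_sub_left] at h1
  nlinarith [sq_nonneg ‖proj (polar D) v - k‖]

/-- The function `‖Π v‖²/2` is convex with gradient `Π`, and its convexity gap controls the
distance between the projections. -/
lemma norm_proj_sq_add_le [CompleteSpace E] {D : Set E} (v m : E) :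
    ‖proj (polar D) m‖ ^ 2 + 2 * (inner ℝ (proj (polar D) m) (v - m) : ℝ) +
      ‖proj (polar D) v - proj (polar D) m‖ ^ 2 ≤ ‖proj (polar D) v‖ ^ 2 := by
  obtain ⟨hm, hm0, -⟩ := proj_polar_spec D m
  obtain ⟨-, -, hv⟩ := proj_polar_spec D v
  have h1 := hv _ hm
  have h2 := norm_sub_sq_real (proj (polar D) v) (proj (polar D) m)
  rw [inner_sub_left] at h1 hm0
  rw [inner_sub_right, real_inner_comm v, real_inner_comm m]
  rw [real_inner_self_eq_norm_sq] at hm0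
  linarith

/-- Uniform midpoint convexity of `‖Π v‖²` with respect to `Π v`. -/
lemma norm_proj_midpoint_sq_le [CompleteSpace E] {D : Set E} (v₁ v₂ m : E)
    (hm : v₁ + v₂ = (2 : ℝ) • m) :
    ‖proj (polar D) m‖ ^ 2 + ‖proj (polar D) v₁ - proj (polar D) v₂‖ ^ 2 / 4 ≤
      (‖proj (polar D) v₁‖ ^ 2 + ‖proj (polar D) v₂‖ ^ 2) / 2 := by
  have h1 := norm_proj_sq_add_le (D := D) v₁ m
  have h2 := norm_proj_sq_add_le (D := D) v₂ m
  set a := proj (polar D) v₁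
  set b := proj (polar D) v₂
  set c := proj (polar D) m
  have h3 : (inner ℝ c (v₁ - m) : ℝ) + (inner ℝ c (v₂ - m) : ℝ) = 0 := by
    have h0 : v₁ - m + (v₂ - m) = 0 := by
      rw [show v₁ - m + (v₂ - m) = (v₁ + v₂) - (2 : ℝ) • m by module, hm, sub_self]
    rw [← inner_add_right, h0, inner_zero_right]
  have h4 : ‖a - b‖ ≤ ‖a - c‖ + ‖b - c‖ := by
    rw [← norm_neg (b - c), neg_sub]
    exact norm_sub_le_norm_sub_add_norm_sub a c b
  have h5 : ‖a - b‖ ^ 2 ≤ (‖a - c‖ + ‖b - c‖) ^ 2 := pow_le_pow_left₀ (norm_nonneg _) h4 2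
  nlinarith [sq_nonneg (‖a - c‖ - ‖b - c‖)]

end ExtendedFunctions

noncomputable section

namespace CCCP

variable {W X Y : Type*}
  [NormedAddCommGroup W] [InnerProductSpace ℝ W] [FiniteDimensional ℝ W]
  [NormedAddCommGroup X] [InnerProductSpace ℝ X] [FiniteDimensional ℝ X]
  [NormedAddCommGroup Y] [InnerProductSpace ℝ Y] [FiniteDimensional ℝ Y]
  {P : CCCP W X Y} {σ : ℝ} {y : Y} {x : X} {Lh Lp Lps : ℝ≥0}

/-! ### Real-valued objectives and weak duality -/

/-- The set of points at which the primal objective is finite. -/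
def primalDom (P : CCCP W X Y) : Set X := {x | x ∈ effDom P.p ∧ P.A x ∈ effDom P.h}

/-- The set `dom h* × Q° × dom p*`, on which the dual objective is finite. -/
def dualDom (P : CCCP W X Y) : Set (DualSpace W X Y) :=
  {z | z.fst ∈ effDom (conj P.h) ∧ z.snd.fst ∈ P.Qpolar ∧ z.snd.snd ∈ effDom (conj P.p)}

/-- The dual residual `A* w + B* y + s + c` as a function of `z = (w, y, s)`. -/
def resid (P : CCCP W X Y) (z : DualSpace W X Y) : X := P.dualRes z.fst z.snd.fst z.snd.snd

/-- Real-valued version of `CCCP.fk`, which it represents on `CCCP.primalDom`. -/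
def fkReal (P : CCCP W X Y) (σ : ℝ) (y : Y) (x : X) : ℝ :=
  (P.h (P.A x)).toReal + inner ℝ P.c x + (P.p x).toReal +
    1 / (2 * σ) * (‖P.yt σ y x‖ ^ 2 - ‖y‖ ^ 2)

/-- Real-valued version of `CCCP.g0`, which it represents on `CCCP.dualDom`. -/
def g0Real (P : CCCP W X Y) (z : DualSpace W X Y) : ℝ :=
  -(conj P.h z.fst).toReal - inner ℝ P.b z.snd.fst - (conj P.p z.snd.snd).toReal

/-- Real-valued version of `CCCP.gk`, which it represents on `CCCP.dualDom`. -/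
def gkReal (P : CCCP W X Y) (σ : ℝ) (y : Y) (z : DualSpace W X Y) : ℝ :=
  P.g0Real z - 1 / (2 * σ) * ‖z.snd.fst - y‖ ^ 2

lemma mem_FD2_iff {z : DualSpace W X Y} : z ∈ P.FD2 ↔ z ∈ P.dualDom ∧ P.resid z = 0 := by
  simp only [FD2, dualDom, resid, Set.mem_ofPred_eq]
  tauto

lemma Admissible.mem_primalDom (hx : P.Admissible x) : x ∈ P.primalDom :=
  ⟨hx.1, interior_subset hx.2⟩

lemma conj_h_ne_bot (P : CCCP W X Y) (w : W) : conj P.h w ≠ ⊥ :=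
  conj_ne_bot P.h_pcc.ne_bot P.h_pcc.nonempty_effDom w

lemma conj_p_ne_bot (P : CCCP W X Y) (s : X) : conj P.p s ≠ ⊥ :=
  conj_ne_bot P.p_pcc.ne_bot P.p_pcc.nonempty_effDom s

lemma fk_eq_coe (hx : x ∈ P.primalDom) : P.fk σ y x = (P.fkReal σ y x : EReal) := by
  rw [fk, f0, fkReal, ← coe_toReal_of_mem_effDom P.h_pcc.ne_bot hx.2,
    ← coe_toReal_of_mem_effDom P.p_pcc.ne_bot hx.1]
  simp only [EReal.coe_add, EReal.toReal_coe]
  rfl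

lemma fk_eq_top (hx : x ∉ P.primalDom) : P.fk σ y x = ⊤ := by
  have h : P.f0 x = ⊤ := by
    rw [f0]
    by_cases hp : x ∈ effDom P.p
    · have hh : P.A x ∉ effDom P.h := fun hh => hx ⟨hp, hh⟩
      rw [eq_top_of_notMem_effDom hh, EReal.top_add_coe,
        EReal.top_add_of_ne_bot (P.p_pcc.ne_bot x)]
    · rw [eq_top_of_notMem_effDom hp]
      refine EReal.add_top_of_ne_bot ?_
      exact EReal.add_ne_bot_iff.mpr ⟨P.h_pcc.ne_bot _, EReal.coe_ne_bot _⟩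
  rw [fk, h, EReal.top_add_coe]

lemma g0_eq_coe {z : DualSpace W X Y} (hz : z ∈ P.dualDom) : P.g0 z = (P.g0Real z : EReal) := by
  rw [g0, g0Real, ← coe_toReal_of_mem_effDom (conj_h_ne_bot P) hz.1,
    ← coe_toReal_of_mem_effDom (conj_p_ne_bot P) hz.2.2]
  simp only [EReal.coe_sub, EReal.coe_neg, EReal.toReal_coe]

lemma gk_eq_coe {z : DualSpace W X Y} (hz : z ∈ P.dualDom) :
    P.gk σ y z = (P.gkReal σ y z : EReal) := by
  rw [gk, gkReal, g0_eq_coe hz, EReal.coe_sub]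

lemma yt_mem_Qpolar (P : CCCP W X Y) (σ : ℝ) (y : Y) (x : X) : P.yt σ y x ∈ P.Qpolar :=
  have : CompleteSpace Y := FiniteDimensional.complete ℝ Y
  (proj_polar_spec _ _).1

lemma inner_adjoint_right (T : X →ₗ[ℝ] W) (x : X) (w : W) :
    (inner ℝ x (LinearMap.adjoint T w) : ℝ) = inner ℝ (T x) w :=
  LinearMap.adjoint_inner_right T x w

/-- Weak duality for the subproblem, at an arbitrary point of `dom h* × Q° × dom p*`. -/
lemma gkReal_add_inner_resid_le (hσ : 0 < σ) (hx : x ∈ P.primalDom) {z : DualSpace W X Y}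
    (hz : z ∈ P.dualDom) : P.gkReal σ y z + inner ℝ x (P.resid z) ≤ P.fkReal σ y x := by
  have : CompleteSpace Y := FiniteDimensional.complete ℝ Y
  have h1 := inner_le_toReal_add_toReal_conj P.h_pcc.ne_bot hx.2 hz.1
  have h2 := inner_le_toReal_add_toReal_conj P.p_pcc.ne_bot hx.1 hz.2.2
  have h3 := two_inner_sub_sq_le_norm_proj_sq (y + σ • (P.B x - P.b)) hz.2.1
  have h4 : (inner ℝ (P.B x) z.snd.fst : ℝ) - inner ℝ P.b z.snd.fst -
      1 / (2 * σ) * ‖z.snd.fst - y‖ ^ 2 ≤ 1 / (2 * σ) * (‖P.yt σ y x‖ ^ 2 - ‖y‖ ^ 2) := by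
    have h5 : 2 * σ * ((inner ℝ (P.B x) z.snd.fst : ℝ) - inner ℝ P.b z.snd.fst) -
        ‖z.snd.fst - y‖ ^ 2 ≤ ‖P.yt σ y x‖ ^ 2 - ‖y‖ ^ 2 := by
      rw [inner_add_left, real_inner_smul_left, inner_sub_left] at h3
      rw [norm_sub_sq_real, real_inner_comm y]
      change _ ≤ ‖P.yt σ y x‖ ^ 2 at h3
      linarith
    have h6 := mul_le_mul_of_nonneg_left h5 (show (0 : ℝ) ≤ 1 / (2 * σ) by positivity)
    have h7 : 1 / (2 * σ) * (2 * σ * ((inner ℝ (P.B x) z.snd.fst : ℝ) - inner ℝ P.b z.snd.fst) -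
        ‖z.snd.fst - y‖ ^ 2) = (inner ℝ (P.B x) z.snd.fst : ℝ) - inner ℝ P.b z.snd.fst -
      1 / (2 * σ) * ‖z.snd.fst - y‖ ^ 2 := by field_simp
    linarith
  rw [gkReal, g0Real, fkReal, resid, dualRes]
  simp only [inner_add_right, inner_adjoint_right]
  rw [real_inner_comm x P.c]
  linarith

lemma gkReal_le_fkReal (hσ : 0 < σ) (hx : x ∈ P.primalDom) {z : DualSpace W X Y}
    (hz : z ∈ P.FD2) : P.gkReal σ y z ≤ P.fkReal σ y x := by
  obtain ⟨hz, hr⟩ := mem_FD2_iff.mp hz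
  have := gkReal_add_inner_resid_le (y := y) hσ hx hz
  rwa [hr, inner_zero_right, add_zero] at this

lemma gkReal_le_iInf (hσ : 0 < σ) {z : DualSpace W X Y} (hz : z ∈ P.FD2) :
    (P.gkReal σ y z : EReal) ≤ ⨅ u, P.fk σ y u := by
  refine le_iInf fun u => ?_
  by_cases hu : u ∈ P.primalDom
  · rw [fk_eq_coe hu, EReal.coe_le_coe_iff]
    exact gkReal_le_fkReal hσ hu hz
  · rw [fk_eq_top hu]
    exact le_top

/-- The value of the subproblem is real as soon as both problems are feasible. -/
lemma exists_iInf_eq_coe (hσ : 0 < σ) (hF : P.FD2.Nonempty) (hx : x ∈ P.primalDom) :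
    ∃ m : ℝ, (⨅ u, P.fk σ y u) = (m : EReal) ∧ (∀ u ∈ P.primalDom, m ≤ P.fkReal σ y u) ∧
      ∀ z ∈ P.FD2, P.gkReal σ y z ≤ m := by
  obtain ⟨z, hz⟩ := hF
  have hbot : (⨅ u, P.fk σ y u) ≠ ⊥ := fun h =>
    EReal.coe_ne_bot _ (le_bot_iff.mp (h ▸ gkReal_le_iInf (y := y) hσ hz))
  have htop : (⨅ u, P.fk σ y u) ≠ ⊤ := by
    have h := iInf_le (fun u => P.fk σ y u) x
    rw [fk_eq_coe hx] at h
    exact ne_of_lt (h.trans_lt (EReal.coe_lt_top _))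
  refine ⟨(⨅ u, P.fk σ y u).toReal, (EReal.coe_toReal htop hbot).symm, fun u hu => ?_,
    fun z hz => ?_⟩
  · have h := iInf_le (fun u => P.fk σ y u) u
    rwa [fk_eq_coe hu, ← EReal.coe_toReal htop hbot, EReal.coe_le_coe_iff] at h
  · have h := gkReal_le_iInf (y := y) hσ hz
    rwa [← EReal.coe_toReal htop hbot, EReal.coe_le_coe_iff] at h

lemma gapLe_of_le (hσ : 0 < σ) (hx : x ∈ P.primalDom) {τ : ℝ}
    (h : ∀ δ > 0, ∃ z ∈ P.FD2, P.fkReal σ y x ≤ P.gkReal σ y z + τ + δ) : P.GapLe σ y x τ := by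
  obtain ⟨z₀, hz₀, -⟩ := h 1 one_pos
  obtain ⟨m, hm, -, hg⟩ := exists_iInf_eq_coe (y := y) hσ ⟨z₀, hz₀⟩ hx
  rw [GapLe, hm, fk_eq_coe hx, ← EReal.coe_add, EReal.coe_le_coe_iff]
  refine le_of_forall_pos_le_add fun δ hδ => ?_
  obtain ⟨z, hz, hle⟩ := h δ hδ
  linarith [hg z hz]

/-! ### The dual feasible set: concavity, Slater points, error bound -/

lemma resid_combo {a b : ℝ} (hab : a + b = 1) (z z' : DualSpace W X Y) :
    P.resid (a • z + b • z') = a • P.resid z + b • P.resid z' := by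
  have hc : P.c = a • P.c + b • P.c := by rw [← add_smul, hab, one_smul]
  simp only [resid, dualRes, WithLp.add_fst, WithLp.add_snd, WithLp.smul_fst, WithLp.smul_snd,
    map_add, map_smul, smul_add]
  nth_rewrite 1 [hc]
  abel

lemma convex_dualDom (P : CCCP W X Y) : Convex ℝ P.dualDom := by
  intro z hz z' hz' a b ha hb hab
  refine ⟨?_, ?_, ?_⟩
  · exact (convexOn_toReal_conj P.h_pcc.ne_bot P.h_pcc.nonempty_effDom).1 hz.1 hz'.1 ha hb hab
  · exact convex_polar _ hz.2.1 hz'.2.1 ha hb hab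
  · exact (convexOn_toReal_conj P.p_pcc.ne_bot P.p_pcc.nonempty_effDom).1 hz.2.2 hz'.2.2 ha hb hab

/-- The regularized dual objective is strongly concave in its second component. -/
lemma gkReal_combo_ge (σ : ℝ) (y : Y) {z z' : DualSpace W X Y} (hz : z ∈ P.dualDom)
    (hz' : z' ∈ P.dualDom) {a b : ℝ} (ha : 0 ≤ a) (hb : 0 ≤ b) (hab : a + b = 1) :
    a * P.gkReal σ y z + b * P.gkReal σ y z' +
      1 / (2 * σ) * (a * b * ‖z.snd.fst - z'.snd.fst‖ ^ 2) ≤ P.gkReal σ y (a • z + b • z') := by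
  have h1 := (convexOn_toReal_conj P.h_pcc.ne_bot P.h_pcc.nonempty_effDom).2
    hz.1 hz'.1 ha hb hab
  have h2 := (convexOn_toReal_conj P.p_pcc.ne_bot P.p_pcc.nonempty_effDom).2
    hz.2.2 hz'.2.2 ha hb hab
  simp only [smul_eq_mul] at h1 h2
  have h3 : ‖a • z.snd.fst + b • z'.snd.fst - y‖ ^ 2 = a * ‖z.snd.fst - y‖ ^ 2 +
      b * ‖z'.snd.fst - y‖ ^ 2 - a * b * ‖z.snd.fst - z'.snd.fst‖ ^ 2 := by
    obtain rfl : a = 1 - b := by linarith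
    have e1 : (1 - b) • z.snd.fst + b • z'.snd.fst - y =
        (z.snd.fst - y) - b • (z.snd.fst - z'.snd.fst) := by module
    have e2 : z'.snd.fst - y = (z.snd.fst - y) - (z.snd.fst - z'.snd.fst) := by abel
    rw [e1, e2, norm_sub_sq_real, norm_sub_sq_real (z.snd.fst - y), inner_smul_right, norm_smul,
      mul_pow, Real.norm_eq_abs, sq_abs]
    ring
  rw [gkReal, gkReal, gkReal, g0Real, g0Real, g0Real]
  simp only [WithLp.add_fst, WithLp.add_snd, WithLp.smul_fst, WithLp.smul_snd, inner_add_right,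
    inner_smul_right]
  rw [h3]
  linarith

open scoped Pointwise in
/-- The Robinson constraint qualification provides finitely many points of `dom h* × Q° × dom p*`
whose residuals span a neighbourhood of the origin. Since `dom h*` is open, its absence from the
constraint qualification is harmless after a contraction toward the feasible point. -/
lemma exists_resid_hull (hopen : IsOpen (effDom (conj P.h))) {zb : DualSpace W X Y}
    (hzb : zb ∈ P.FD2) (hR : P.RCQ zb) :
    ∃ (n : ℕ) (z : Fin n → DualSpace W X Y) (ρ : ℝ), 0 < ρ ∧ (∀ i, z i ∈ P.dualDom) ∧
      Metric.closedBall 0 ρ ⊆ convexHull ℝ (Set.range fun i => P.resid (z i)) := by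
  obtain ⟨hzd, hz0⟩ := mem_FD2_iff.mp hzb
  rw [RCQ, mem_interior_iff_mem_nhds] at hR
  have hcont : Continuous fun u : X => ((u, 0, 0) : X × Y × X) := by fun_prop
  obtain ⟨e, he, hsub⟩ := exists_mem_interior_convexHull_affineBasis
    (hcont.continuousAt.preimage_mem_nhds (x := (0 : X)) (by exact hR))
  have hpt : ∀ i, ∃ z : DualSpace W X Y, z.snd.fst ∈ P.Qpolar ∧
      z.snd.snd ∈ effDom (conj P.p) ∧ P.resid z = e i := by
    intro i
    obtain ⟨w, v, s, v', hv', d, hd, heq⟩ := hsub (subset_convexHull ℝ _ (Set.mem_range_self i))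
    simp only [Prod.mk.injEq] at heq
    obtain ⟨h1, h2, h3⟩ := heq
    refine ⟨mkDual (zb.fst + w) (zb.snd.fst + v) (zb.snd.snd + s), ?_, ?_, ?_⟩
    · exact sub_eq_zero.mp h2.symm ▸ hv'
    · exact sub_eq_zero.mp h3.symm ▸ hd
    · rw [h1]
      simp only [resid, dualRes, mkDual]
      change LinearMap.adjoint P.A (zb.fst + w) + LinearMap.adjoint P.B (zb.snd.fst + v) +
        (zb.snd.snd + s) + P.c = _
      rw [map_add, map_add]
      abel
  choose z hzQ hzp hzr using hpt
  have hev : ∀ᶠ θ : ℝ in 𝓝[>] 0, ∀ i, (1 - θ) • zb.fst + θ • (z i).fst ∈ effDom (conj P.h) := by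
    rw [eventually_all]
    intro i
    have hc : ContinuousAt (fun θ : ℝ => (1 - θ) • zb.fst + θ • (z i).fst) 0 := by fun_prop
    refine nhdsWithin_le_nhds (hc.preimage_mem_nhds (hopen.mem_nhds ?_))
    simpa using hzd.1
  obtain ⟨θ, hθ, hθ0, hθ1⟩ := (hev.and (Ioo_mem_nhdsGT one_pos)).exists
  have hres : ∀ i, P.resid ((1 - θ) • zb + θ • z i) = θ • e i := fun i => by
    rw [resid_combo (by ring), hz0, smul_zero, zero_add, hzr]
  have h0 : (0 : X) ∈ interior (convexHull ℝ
      (Set.range fun i => P.resid ((1 - θ) • zb + θ • z i))) := by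
    have hr : (Set.range fun i => P.resid ((1 - θ) • zb + θ • z i)) = θ • Set.range e := by
      ext u
      simp only [hres, Set.mem_range, Set.mem_smul_set, exists_exists_eq_and]
    rw [hr, convexHull_smul, interior_smul₀ hθ0.ne']
    exact ⟨0, he, smul_zero θ⟩
  obtain ⟨ρ, hρ, hball⟩ := Metric.mem_nhds_iff.mp (mem_interior_iff_mem_nhds.mp h0)
  refine ⟨_, fun i => (1 - θ) • zb + θ • z i, ρ / 2, by positivity, fun i => ?_,
    (Metric.closedBall_subset_ball (by linarith)).trans hball⟩
  refine ⟨hθ i, ?_, ?_⟩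
  · exact convex_polar _ hzd.2.1 (hzQ i) (by linarith) hθ0.le (by ring)
  · exact (convexOn_toReal_conj P.p_pcc.ne_bot P.p_pcc.nonempty_effDom).1 hzd.2.2 (hzp i)
      (by linarith) hθ0.le (by ring)

/-- Global error bound: a point `z` of the convex set `dom h* × Q° × dom p*` is moved to
feasibility along the segment to a bounded point with residual opposite to that of `z`. -/
lemma exists_isErrorBound (hopen : IsOpen (effDom (conj P.h))) {zb : DualSpace W X Y}
    (hzb : zb ∈ P.FD2) (hR : P.RCQ zb) : ∃ γ, P.IsErrorBound γ := by
  obtain ⟨n, z, ρ, hρ, hz, hball⟩ := exists_resid_hull hopen hzb hR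
  obtain ⟨M, hM⟩ := ((Set.finite_range z).isCompact_convexHull ℝ).isBounded.exists_norm_le
  have hsol : ∀ u : X, ‖u‖ ≤ ρ → ∃ v ∈ P.dualDom, P.resid v = u ∧ ‖v‖ ≤ M := by
    intro u hu
    have himg : convexHull ℝ (Set.range fun i => P.resid (z i)) ⊆
        P.resid '' convexHull ℝ (Set.range z) := by
      refine convexHull_min ?_ ?_
      · rintro _ ⟨i, rfl⟩
        exact ⟨z i, subset_convexHull ℝ _ (Set.mem_range_self i), rfl⟩
      · rintro _ ⟨v, hv, rfl⟩ _ ⟨v', hv', rfl⟩ a b ha hb hab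
        exact ⟨a • v + b • v', convex_convexHull ℝ _ hv hv' ha hb hab, resid_combo hab v v'⟩
    obtain ⟨v, hv, rfl⟩ := himg (hball (mem_closedBall_zero_iff.mpr hu))
    exact ⟨v, convexHull_min (by rintro _ ⟨i, rfl⟩; exact hz i) (convex_dualDom P) hv, rfl,
      hM v hv⟩
  refine ⟨max 1 (max 1 M / ρ), le_max_left _ _, fun w hw v hv s hs => ?_⟩
  set q : DualSpace W X Y := mkDual w v s with hq
  have hqd : q ∈ P.dualDom := ⟨hw, hv, hs⟩
  change Metric.infDist q P.FD2 ≤ _ * _ * ‖P.resid q‖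
  set r := P.resid q with hr
  rcases eq_or_ne r 0 with h0 | h0
  · rw [Metric.infDist_zero_of_mem (mem_FD2_iff.mpr ⟨hqd, h0⟩), h0]
    simp
  have hrpos : 0 < ‖r‖ := norm_pos_iff.mpr h0
  obtain ⟨v', hv'd, hv'r, hv'M⟩ := hsol (-(ρ / ‖r‖) • r) (by
    rw [norm_smul, norm_neg, Real.norm_of_nonneg (by positivity), div_mul_cancel₀ _ hrpos.ne'])
  set θ := ‖r‖ / (ρ + ‖r‖) with hθ
  have hθ0 : 0 ≤ θ := by positivity
  have hθ1 : 0 ≤ 1 - θ := by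
    rw [hθ, one_sub_div (by positivity)]
    have : ρ + ‖r‖ - ‖r‖ = ρ := by ring
    rw [this]
    positivity
  have hmem : (1 - θ) • q + θ • v' ∈ P.FD2 := by
    refine mem_FD2_iff.mpr ⟨convex_dualDom P hqd hv'd hθ1 hθ0 (by ring), ?_⟩
    rw [resid_combo (by ring), hv'r, ← hr, smul_smul, ← add_smul]
    have : 1 - θ + θ * -(ρ / ‖r‖) = 0 := by
      rw [hθ]
      field_simp
      ring
    rw [this, zero_smul]
  refine (Metric.infDist_le_dist_of_mem hmem).trans ?_
  have hd : dist q ((1 - θ) • q + θ • v') = θ * ‖q - v'‖ := by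
    rw [dist_eq_norm, show q - ((1 - θ) • q + θ • v') = θ • (q - v') by module, norm_smul,
      Real.norm_of_nonneg hθ0]
  rw [hd]
  have h1 : θ ≤ ‖r‖ / ρ := by
    rw [hθ]
    gcongr
    linarith
  have h2 : ‖q - v'‖ ≤ max 1 M * (1 + ‖q‖) := by
    have := norm_sub_le q v'
    have := le_max_left 1 M
    have := le_max_right 1 M
    nlinarith [norm_nonneg q]
  calc θ * ‖q - v'‖ ≤ ‖r‖ / ρ * (max 1 M * (1 + ‖q‖)) :=
        mul_le_mul h1 h2 (norm_nonneg _) (by positivity)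
    _ = max 1 M / ρ * (1 + ‖q‖) * ‖r‖ := by ring
    _ ≤ max 1 (max 1 M / ρ) * (1 + ‖q‖) * ‖r‖ := by
        gcongr
        exact le_max_right _ _

/-- Coercivity of the subproblem objective, from weak duality at finitely many points whose
residuals span a neighbourhood of the origin. -/
lemma exists_mul_norm_le_fkReal (hopen : IsOpen (effDom (conj P.h))) {zb : DualSpace W X Y}
    (hzb : zb ∈ P.FD2) (hR : P.RCQ zb) (hσ : 0 < σ) (y : Y) :
    ∃ ρ > 0, ∃ C, ∀ x ∈ P.primalDom, ρ * ‖x‖ ≤ P.fkReal σ y x + C := by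
  obtain ⟨n, z, ρ, hρ, hz, hball⟩ := exists_resid_hull hopen hzb hR
  obtain ⟨C, hC⟩ := (Set.finite_range fun i => -P.gkReal σ y (z i)).bddAbove
  refine ⟨ρ, hρ, C, fun x hx => ?_⟩
  have hhull : convexHull ℝ (Set.range fun i => P.resid (z i)) ⊆
      {u | (inner ℝ x u : ℝ) ≤ P.fkReal σ y x + C} := by
    refine convexHull_min ?_ (convex_halfSpace_le (innerₗ X x).isLinear _)
    rintro _ ⟨i, rfl⟩
    have h1 := gkReal_add_inner_resid_le (y := y) hσ hx (hz i)
    have h2 := hC (Set.mem_range_self i)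
    simp only [Set.mem_ofPred_eq] at h2 ⊢
    linarith
  rcases eq_or_ne x 0 with rfl | h0
  · have := hhull (hball (Metric.mem_closedBall_self hρ.le))
    simpa using this
  have hpos : 0 < ‖x‖ := norm_pos_iff.mpr h0
  have := hhull (hball (a := (ρ / ‖x‖) • x) (by
    rw [mem_closedBall_zero_iff, norm_smul, Real.norm_of_nonneg (by positivity),
      div_mul_cancel₀ _ hpos.ne']))
  rw [Set.mem_ofPred_eq, inner_smul_right, real_inner_self_eq_norm_sq, sq, ← mul_assoc,
    div_mul_cancel₀ _ hpos.ne'] at this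
  exact this

/-! ### The dual candidate attached to an admissible point -/

lemma nonempty_effDom_conj_p (hF : P.FD2.Nonempty) : (effDom (conj P.p)).Nonempty :=
  let ⟨_, hz⟩ := hF
  ⟨_, (mem_FD2_iff.mp hz).1.2.2⟩

lemma wt_spec (hx : P.Admissible x) : P.wt x ∈ effDom (conj P.h) ∧
    (P.h (P.A x)).toReal + (conj P.h (P.wt x)).toReal = (inner ℝ (P.A x) (P.wt x) : ℝ) := by
  have : CompleteSpace W := FiniteDimensional.complete ℝ W
  have hd : DifferentiableAt ℝ (fun v => (P.h v).toReal) (P.A x) :=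
    P.h_smooth.differentiableOn.differentiableAt (isOpen_interior.mem_nhds hx.2)
  exact conj_of_subgradient P.h_pcc.ne_bot (interior_subset hx.2) fun v hv =>
    add_inner_gradient_le (convexOn_toReal P.h_pcc) (interior_subset hx.2) hv
      (hasGradientAt_grad hd)

lemma sub_ek (P : CCCP W X Y) (σ : ℝ) (y : Y) (x : X) :
    x - P.ek σ y x = prox P.p (P.proxArg σ y x) := sub_sub_cancel _ _

lemma sub_ek_mem (hF : P.FD2.Nonempty) (σ : ℝ) (y : Y) (x : X) :
    x - P.ek σ y x ∈ effDom P.p := by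
  rw [sub_ek]
  exact (prox_subgradient P.p_pcc (nonempty_effDom_conj_p hF) _).1

/-- `s̃` is a subgradient of `p` at `x - e`. -/
lemma st_spec (hF : P.FD2.Nonempty) (σ : ℝ) (y : Y) (x : X) :
    P.st σ y x ∈ effDom (conj P.p) ∧
    (P.p (x - P.ek σ y x)).toReal + (conj P.p (P.st σ y x)).toReal =
      (inner ℝ (x - P.ek σ y x) (P.st σ y x) : ℝ) := by
  have hc := nonempty_effDom_conj_p hF
  obtain ⟨h1, h2⟩ := prox_subgradient P.p_pcc hc (P.proxArg σ y x)
  rw [sub_ek, st, prox_conj P.p_pcc hc]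
  exact conj_of_subgradient P.p_pcc.ne_bot h1 h2

lemma resid_zt (hF : P.FD2.Nonempty) (σ : ℝ) (y : Y) (x : X) :
    P.resid (P.zt σ y x) = P.ek σ y x := by
  change LinearMap.adjoint P.A (P.wt x) + LinearMap.adjoint P.B (P.yt σ y x) + P.st σ y x + P.c = _
  rw [st, prox_conj P.p_pcc (nonempty_effDom_conj_p hF), ek]
  conv_lhs => rw [proxArg]
  abel

lemma zt_mem_dualDom (hF : P.FD2.Nonempty) (σ : ℝ) (y : Y) (hx : P.Admissible x) :
    P.zt σ y x ∈ P.dualDom :=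
  ⟨(wt_spec hx).1, yt_mem_Qpolar P σ y x, (st_spec hF σ y x).1⟩

/-- The gap between the primal value at `x` and the dual value at `z̃(x)` is
`⟨x - s̃, e⟩ + p x - p (x - e)`. -/
lemma fkReal_le_gkReal_zt (hp : LipschitzOnWith Lp (fun x => (P.p x).toReal) (effDom P.p))
    (hF : P.FD2.Nonempty) (hσ : 0 < σ) (y : Y) (hx : P.Admissible x) :
    P.fkReal σ y x ≤ P.gkReal σ y (P.zt σ y x) +
      (‖x‖ + ‖P.st σ y x‖ + Lp) * ‖P.ek σ y x‖ := by
  have : CompleteSpace Y := FiniteDimensional.complete ℝ Y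
  have hw := (wt_spec hx).2
  have hs := (st_spec hF σ y x).2
  have hr : (inner ℝ x (P.resid (P.zt σ y x)) : ℝ) = inner ℝ x (P.ek σ y x) := by
    rw [resid_zt hF]
  change (inner ℝ x (LinearMap.adjoint P.A (P.wt x) + LinearMap.adjoint P.B (P.yt σ y x) +
    P.st σ y x + P.c) : ℝ) = _ at hr
  simp only [inner_add_right, inner_adjoint_right] at hr
  have hlip := hp.dist_le_mul _ hx.1 _ (sub_ek_mem hF σ y x)
  rw [dist_eq_norm, dist_eq_norm, sub_sub_cancel] at hlip
  have hlip' := (le_abs_self _).trans hlip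
  have hproj : (inner ℝ (y + σ • (P.B x - P.b) - P.yt σ y x) (P.yt σ y x) : ℝ) = 0 :=
    (proj_polar_spec _ _).2.1
  have hq : 1 / (2 * σ) * (‖P.yt σ y x‖ ^ 2 - ‖y‖ ^ 2) +
      1 / (2 * σ) * ‖P.yt σ y x - y‖ ^ 2 =
      (inner ℝ (P.B x) (P.yt σ y x) : ℝ) - inner ℝ P.b (P.yt σ y x) := by
    rw [inner_sub_left, inner_add_left, real_inner_smul_left, inner_sub_left,
      real_inner_self_eq_norm_sq] at hproj
    rw [norm_sub_sq_real, real_inner_comm y]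
    field_simp
    linarith
  have h1 : (inner ℝ x (P.ek σ y x) : ℝ) ≤ ‖x‖ * ‖P.ek σ y x‖ := real_inner_le_norm _ _
  have h2 : -(inner ℝ (P.ek σ y x) (P.st σ y x) : ℝ) ≤ ‖P.ek σ y x‖ * ‖P.st σ y x‖ :=
    (neg_le_abs _).trans (abs_real_inner_le_norm _ _)
  rw [inner_sub_left] at hs
  rw [fkReal, gkReal, g0Real]
  change _ ≤ -(conj P.h (P.wt x)).toReal - inner ℝ P.b (P.yt σ y x) -
    (conj P.p (P.st σ y x)).toReal - 1 / (2 * σ) * ‖P.yt σ y x - y‖ ^ 2 + _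
  rw [real_inner_comm x P.c]
  linarith

/-! ### From the scaled residual bound to the gap -/

omit [InnerProductSpace ℝ W] [FiniteDimensional ℝ W] [InnerProductSpace ℝ X]
  [FiniteDimensional ℝ X] [InnerProductSpace ℝ Y] [FiniteDimensional ℝ Y] in
lemma norm_snd_fst_le (z : DualSpace W X Y) : ‖z.snd.fst‖ ≤ ‖z‖ :=
  (WithLp.norm_fst_le _ z.snd).trans (WithLp.norm_snd_le _ z)

omit [InnerProductSpace ℝ W] [FiniteDimensional ℝ W] [InnerProductSpace ℝ X]
  [FiniteDimensional ℝ X] [InnerProductSpace ℝ Y] [FiniteDimensional ℝ Y] in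
lemma norm_snd_snd_le (z : DualSpace W X Y) : ‖z.snd.snd‖ ≤ ‖z‖ :=
  (WithLp.norm_snd_le _ z.snd).trans (WithLp.norm_snd_le _ z)

/-- Sensitivity of the regularized dual objective. -/
lemma gkReal_le_add (h1 : P.Assumption1 Lh)
    (hps : LipschitzOnWith Lps (fun s => (conj P.p s).toReal) (effDom (conj P.p)))
    (hσ : 0 < σ) (y : Y) {z z' : DualSpace W X Y} (hz : z ∈ P.dualDom) (hz' : z' ∈ P.dualDom)
    {d : ℝ} (hd : ‖z' - z‖ ≤ d) :
    P.gkReal σ y z ≤ P.gkReal σ y z' +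
      (d * (‖grad (conj P.h) z.fst‖ + ‖z.snd.fst - y‖ / σ + ‖P.b‖ + Lps) +
        d ^ 2 / 2 * (Lh + 1 / σ)) := by
  have : CompleteSpace W := FiniteDimensional.complete ℝ W
  have hd0 : 0 ≤ d := (norm_nonneg _).trans hd
  have hw : ‖z'.fst - z.fst‖ ≤ d := (WithLp.norm_fst_le _ (z' - z)).trans hd
  have hy : ‖z'.snd.fst - z.snd.fst‖ ≤ d := (norm_snd_fst_le (z' - z)).trans hd
  have hs : ‖z'.snd.snd - z.snd.snd‖ ≤ d := (norm_snd_snd_le (z' - z)).trans hd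
  have e1 := le_add_inner_gradient_add_sq (x := z.fst) (v := z'.fst) h1.convex
    (fun w hw => hasGradientAt_grad
      ((h1.contDiffOn.differentiableOn (by simp)).differentiableAt (h1.isOpen.mem_nhds hw)))
    h1.lipschitz hz.1 hz'.1
  have e2 : (inner ℝ (grad (conj P.h) z.fst) (z'.fst - z.fst) : ℝ) ≤
      d * ‖grad (conj P.h) z.fst‖ := by
    rw [mul_comm]
    exact (real_inner_le_norm _ _).trans (mul_le_mul_of_nonneg_left hw (norm_nonneg _))
  have e3 : (Lh : ℝ) / 2 * ‖z'.fst - z.fst‖ ^ 2 ≤ Lh / 2 * d ^ 2 := by gcongr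
  have e4 : (inner ℝ P.b z'.snd.fst : ℝ) - inner ℝ P.b z.snd.fst ≤ d * ‖P.b‖ := by
    rw [← inner_sub_right, mul_comm]
    exact (real_inner_le_norm _ _).trans (mul_le_mul_of_nonneg_left hy (norm_nonneg _))
  have e5 : (conj P.p z'.snd.snd).toReal - (conj P.p z.snd.snd).toReal ≤ d * Lps := by
    have h := hps.dist_le_mul _ hz'.2.2 _ hz.2.2
    rw [dist_eq_norm, dist_eq_norm] at h
    rw [mul_comm]
    exact ((le_abs_self _).trans h).trans (mul_le_mul_of_nonneg_left hs Lps.2)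
  have e6 : 1 / (2 * σ) * ‖z'.snd.fst - y‖ ^ 2 - 1 / (2 * σ) * ‖z.snd.fst - y‖ ^ 2 ≤
      d * (‖z.snd.fst - y‖ / σ) + d ^ 2 / 2 * (1 / σ) := by
    have h : ‖z'.snd.fst - y‖ ≤ d + ‖z.snd.fst - y‖ := by
      rw [show z'.snd.fst - y = (z'.snd.fst - z.snd.fst) + (z.snd.fst - y) by abel]
      exact (norm_add_le _ _).trans (by gcongr)
    have h' : ‖z'.snd.fst - y‖ ^ 2 ≤ (d + ‖z.snd.fst - y‖) ^ 2 := by gcongr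
    rw [← mul_sub]
    calc 1 / (2 * σ) * (‖z'.snd.fst - y‖ ^ 2 - ‖z.snd.fst - y‖ ^ 2)
        ≤ 1 / (2 * σ) * ((d + ‖z.snd.fst - y‖) ^ 2 - ‖z.snd.fst - y‖ ^ 2) := by gcongr
      _ = _ := by
        field_simp
        ring
  rw [gkReal, gkReal, g0Real, g0Real]
  linarith

lemma beta_sq (P : CCCP W X Y) (Lh Lp Lps : ℝ≥0) {γ : ℝ} (hγ : 0 ≤ γ) :
    P.beta Lh Lp Lps γ ^ 2 =
      2 * (1 + (Lp : ℝ) + γ * (‖P.b‖ + (Lps : ℝ)) + γ ^ 2 * (1 + (Lh : ℝ))) :=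
  Real.sq_sqrt (by positivity)

/-- A step of length `2γtμ` changes the dual objective by at most `2t(γ(b + l) + γ²(1 + L))`: the
factor `μ ≤ 1 / (G + s)` absorbs the first-order term in `G` and the second-order term in `s`, for
which `1 ≤ γ` puts a common factor `γ²` in front of both. -/
lemma sensitivity_le {γ t μ G b l L s : ℝ} (hγ : 1 ≤ γ) (ht0 : 0 ≤ t) (ht1 : t ≤ 1) (hμ0 : 0 ≤ μ)
    (hμ1 : μ ≤ 1) (hG : 0 ≤ G) (hs : 0 ≤ s) (hb : 0 ≤ b) (hl : 0 ≤ l) (hL : 0 ≤ L)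
    (hμ : μ * (G + s) ≤ 1) :
    2 * γ * t * μ * (G + b + l) + (2 * γ * t * μ) ^ 2 / 2 * (L + s) ≤
      2 * t * (γ * (b + l) + γ ^ 2 * (1 + L)) := by
  have ht : t ^ 2 ≤ t := by nlinarith
  have hμ2 : μ ^ 2 ≤ μ := by nlinarith
  have htμ : t ^ 2 * μ ^ 2 ≤ t * μ := mul_le_mul ht hμ2 (sq_nonneg _) ht0
  have htμ' : t * μ ≤ t := mul_le_of_le_one_right ht0 hμ1
  have hγ2 : γ ≤ γ ^ 2 := by nlinarith
  have i1 : γ * (t * μ) * (b + l) ≤ γ * t * (b + l) := by gcongr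
  have i2 : γ * (t * μ * G) ≤ γ ^ 2 * (t * μ * G) := by gcongr
  have i3 : γ ^ 2 * (t ^ 2 * μ ^ 2) * s ≤ γ ^ 2 * (t * μ) * s := by gcongr
  have i4 : γ ^ 2 * (t ^ 2 * μ ^ 2) * L ≤ γ ^ 2 * t * L := by
    gcongr
    exact htμ.trans htμ'
  have i5 : γ ^ 2 * t * (μ * (G + s)) ≤ γ ^ 2 * t := mul_le_of_le_one_right (by positivity) hμ
  calc 2 * γ * t * μ * (G + b + l) + (2 * γ * t * μ) ^ 2 / 2 * (L + s)
      = 2 * (γ * (t * μ) * (b + l) + γ * (t * μ * G) + γ ^ 2 * (t ^ 2 * μ ^ 2) * s +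
          γ ^ 2 * (t ^ 2 * μ ^ 2) * L) := by ring
    _ ≤ 2 * (γ * t * (b + l) + γ ^ 2 * (t * μ * G) + γ ^ 2 * (t * μ) * s + γ ^ 2 * t * L) := by
        gcongr
    _ = 2 * (γ * t * (b + l) + γ ^ 2 * t * (μ * (G + s)) + γ ^ 2 * t * L) := by ring
    _ ≤ 2 * (γ * t * (b + l) + γ ^ 2 * t + γ ^ 2 * t * L) := by gcongr
    _ = _ := by ring

/-- Under the scaled residual bound, `z̃(x)` has dual feasible points nearby whose dual values are
within `β² t` of the primal value at `x`. -/
lemma exists_feasible_of_scaledBound (h1 : P.Assumption1 Lh)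
    (hp : LipschitzOnWith Lp (fun x => (P.p x).toReal) (effDom P.p))
    (hps : LipschitzOnWith Lps (fun s => (conj P.p s).toReal) (effDom (conj P.p)))
    (hF : P.FD2.Nonempty) {γ t : ℝ} (hγ : P.IsErrorBound γ) (hσ : 0 < σ) (hx : P.Admissible x)
    (ht0 : 0 ≤ t) (ht1 : t ≤ 1) (hS : P.ScaledBound σ y x (2 * t)) {δ : ℝ} (hδ : 0 < δ) :
    ∃ z ∈ P.FD2, P.fkReal σ y x ≤ P.gkReal σ y z + P.beta Lh Lp Lps γ ^ 2 * t + δ ∧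
      ‖z.snd.fst - P.yt σ y x‖ ≤ 2 * γ * t + δ := by
  have hγ1 : 1 ≤ γ := hγ.1
  have hzt := zt_mem_dualDom hF σ y hx
  have hgap := fkReal_le_gkReal_zt hp hF hσ y hx
  have heb := hγ.2 _ hzt.1 _ hzt.2.1 _ hzt.2.2
  change Metric.infDist (P.zt σ y x) P.FD2 ≤
    γ * (1 + ‖P.zt σ y x‖) * ‖P.resid (P.zt σ y x)‖ at heb
  rw [resid_zt hF] at heb
  have hst : ‖P.st σ y x‖ ≤ ‖P.zt σ y x‖ := norm_snd_snd_le (P.zt σ y x)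
  rw [ScaledBound] at hS
  set e := ‖P.ek σ y x‖
  set N := 1 + ‖x‖ + ‖P.zt σ y x‖ with hN
  set G := ‖grad (conj P.h) (P.wt x)‖
  set D := ‖P.yt σ y x - y‖ / σ with hD
  set μ := min (1 / (G + D + 1 / σ)) 1 with hμ
  have hx0 := norm_nonneg x
  have hz0 := norm_nonneg (P.zt σ y x)
  have he0 : 0 ≤ e := norm_nonneg _
  have hN0 : 0 < N := by positivity
  have hD0 : 0 ≤ D := by positivity
  have hG0 : 0 ≤ G := norm_nonneg _
  have hM0 : 0 < G + D + 1 / σ := by positivity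
  have hμ0 : 0 ≤ μ := le_min (by positivity) zero_le_one
  have hμ1 : μ ≤ 1 := min_le_right _ _
  have hμM : μ * (G + D + 1 / σ) ≤ 1 := by
    calc μ * (G + D + 1 / σ) ≤ 1 / (G + D + 1 / σ) * (G + D + 1 / σ) :=
          mul_le_mul_of_nonneg_right (min_le_left _ _) hM0.le
      _ = 1 := by field_simp
  have hNe : N * e ≤ 2 * t * μ := by
    calc N * e ≤ N * (2 * t / N * μ) := by gcongr
      _ = 2 * t * μ := by field_simp
  -- the limiting distance from `z̃` to the dual feasible set
  set d₀ := 2 * γ * t * μ with hd₀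
  have hdist : Metric.infDist (P.zt σ y x) P.FD2 ≤ d₀ := by
    refine heb.trans ?_
    have : (1 + ‖P.zt σ y x‖) * e ≤ 2 * t * μ :=
      (mul_le_mul_of_nonneg_right (by rw [hN]; linarith) he0).trans hNe
    rw [mul_assoc]
    calc γ * ((1 + ‖P.zt σ y x‖) * e) ≤ γ * (2 * t * μ) := by gcongr
      _ = d₀ := by rw [hd₀]; ring
  have hd₀0 : 0 ≤ d₀ := by positivity
  have hφ : Continuous fun d : ℝ =>
      d * (G + D + ‖P.b‖ + Lps) + d ^ 2 / 2 * (Lh + 1 / σ) := by fun_prop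
  have hev : ∀ᶠ d in 𝓝[>] d₀, d * (G + D + ‖P.b‖ + Lps) + d ^ 2 / 2 * (Lh + 1 / σ) <
      d₀ * (G + D + ‖P.b‖ + Lps) + d₀ ^ 2 / 2 * (Lh + 1 / σ) + δ ∧ d < d₀ + δ ∧ d₀ < d := by
    refine Filter.Eventually.and ?_ (Filter.Eventually.and ?_ self_mem_nhdsWithin)
    · exact nhdsWithin_le_nhds (hφ.continuousAt.eventually_lt continuousAt_const (by linarith))
    · exact nhdsWithin_le_nhds (eventually_lt_nhds (by linarith))
  obtain ⟨d, hd1, hd2, hd3⟩ := hev.exists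
  obtain ⟨z, hz, hzd⟩ := (Metric.infDist_lt_iff hF).mp (hdist.trans_lt hd3)
  rw [dist_comm, dist_eq_norm] at hzd
  refine ⟨z, hz, ?_, ?_⟩
  · have hsens := gkReal_le_add h1 hps hσ y hzt (mem_FD2_iff.mp hz).1 hzd.le
    change _ ≤ _ + (d * (G + D + ‖P.b‖ + Lps) + _) at hsens
    have b1 : (‖x‖ + ‖P.st σ y x‖ + Lp) * e ≤ 2 * t * (1 + Lp) := by
      have hLp : (0 : ℝ) ≤ Lp := Lp.2
      have i1 : (‖x‖ + ‖P.st σ y x‖) * e ≤ N * e :=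
        mul_le_mul_of_nonneg_right (by rw [hN]; linarith) he0
      have i2 : e ≤ N * e := le_mul_of_one_le_left he0 (by rw [hN]; linarith)
      have i3 : 2 * t * μ ≤ 2 * t := mul_le_of_le_one_right (by linarith) hμ1
      have i4 : (Lp : ℝ) * e ≤ Lp * (2 * t) := mul_le_mul_of_nonneg_left (by linarith) hLp
      linarith
    have b2 : d₀ * (G + D + ‖P.b‖ + Lps) + d₀ ^ 2 / 2 * (Lh + 1 / σ) ≤
        2 * t * (γ * (‖P.b‖ + Lps) + γ ^ 2 * (1 + Lh)) :=
      sensitivity_le hγ1 ht0 ht1 hμ0 hμ1 (add_nonneg hG0 hD0) (by positivity) (norm_nonneg _)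
        Lps.2 Lh.2 hμM
    rw [beta_sq P Lh Lp Lps (by linarith)]
    linarith
  · have i1 : d₀ ≤ 2 * γ * t := mul_le_of_le_one_right (by positivity) hμ1
    have i2 : ‖z.snd.fst - P.yt σ y x‖ ≤ ‖z - P.zt σ y x‖ := norm_snd_fst_le (z - P.zt σ y x)
    linarith

lemma gapLe_of_scaledBound (h1 : P.Assumption1 Lh)
    (hp : LipschitzOnWith Lp (fun x => (P.p x).toReal) (effDom P.p))
    (hps : LipschitzOnWith Lps (fun s => (conj P.p s).toReal) (effDom (conj P.p)))
    (hF : P.FD2.Nonempty) {γ t : ℝ} (hγ : P.IsErrorBound γ) (hσ : 0 < σ) (hx : P.Admissible x)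
    (ht0 : 0 ≤ t) (ht1 : t ≤ 1) (hS : P.ScaledBound σ y x (2 * t)) :
    P.GapLe σ y x (P.beta Lh Lp Lps γ ^ 2 * t) :=
  gapLe_of_le hσ hx.mem_primalDom fun δ hδ => by
    obtain ⟨z, hz, h, -⟩ := exists_feasible_of_scaledBound h1 hp hps hF hγ hσ hx ht0 ht1 hS hδ
    exact ⟨z, hz, h⟩

lemma critA'_of_critA'' (h1 : P.Assumption1 Lh)
    (hp : LipschitzOnWith Lp (fun x => (P.p x).toReal) (effDom P.p))
    (hps : LipschitzOnWith Lps (fun s => (conj P.p s).toReal) (effDom (conj P.p)))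
    (hF : P.FD2.Nonempty) {γ ε : ℝ} (hγ : P.IsErrorBound γ) (hσ : 0 < σ) (hx : P.Admissible x)
    (hε : ε ^ 2 / (2 * σ) ≤ 1) (hA : P.CritA'' σ y x ε) :
    P.CritA' σ y x (P.beta Lh Lp Lps γ * ε) := by
  have h := gapLe_of_scaledBound (t := ε ^ 2 / (2 * σ)) h1 hp hps hF hγ hσ hx (by positivity) hε
    (by
      rw [CritA''] at hA
      convert hA using 1
      field_simp)
  rw [CritA']
  convert h using 1
  ring

lemma critB'_of_critB'' (h1 : P.Assumption1 Lh)
    (hp : LipschitzOnWith Lp (fun x => (P.p x).toReal) (effDom P.p))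
    (hps : LipschitzOnWith Lps (fun s => (conj P.p s).toReal) (effDom (conj P.p)))
    (hF : P.FD2.Nonempty) {γ η : ℝ} (hγ : P.IsErrorBound γ) (hσ : 0 < σ) (hx : P.Admissible x)
    (hη : η ^ 2 / (2 * σ) * ‖P.yt σ y x - y‖ ^ 2 ≤ 1) (hB : P.CritB'' σ y x η) :
    P.CritB' σ y x (P.beta Lh Lp Lps γ * η) := by
  have h := gapLe_of_scaledBound (t := η ^ 2 / (2 * σ) * ‖P.yt σ y x - y‖ ^ 2) h1 hp hps hF hγ hσ
    hx (by positivity) hη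
    (by
      rw [CritB''] at hB
      convert hB using 1
      field_simp)
  rw [CritB']
  convert h using 1
  ring

/-! ### Minimizing sequences of a subproblem -/

lemma isBounded_image_of_continuous {E F : Type*} [PseudoMetricSpace E] [ProperSpace E]
    [PseudoMetricSpace F] {φ : E → F} (hφ : Continuous φ) {s : Set E}
    (hs : Bornology.IsBounded s) : Bornology.IsBounded (φ '' s) :=
  (hs.isCompact_closure.image hφ).isBounded.subset (Set.image_mono subset_closure)

lemma isBounded_range_comp {E F : Type*} [PseudoMetricSpace E] [ProperSpace E]
    [PseudoMetricSpace F] {φ : E → F} (hφ : Continuous φ) {u : ℕ → E}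
    (hu : Bornology.IsBounded (Set.range u)) : Bornology.IsBounded (Set.range fun j => φ (u j)) :=
  (isBounded_image_of_continuous hφ hu).subset (by rintro _ ⟨j, rfl⟩; exact ⟨_, ⟨j, rfl⟩, rfl⟩)

lemma isBounded_range_prodMk {E F : Type*} [PseudoMetricSpace E] [PseudoMetricSpace F]
    {u : ℕ → E} {v : ℕ → F} (hu : Bornology.IsBounded (Set.range u))
    (hv : Bornology.IsBounded (Set.range v)) :
    Bornology.IsBounded (Set.range fun j => (u j, v j)) :=
  (hu.prod hv).subset (by rintro _ ⟨j, rfl⟩; exact ⟨⟨j, rfl⟩, ⟨j, rfl⟩⟩)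

lemma isBounded_range_of_eventually_norm_le {E : Type*} [SeminormedAddCommGroup E] {u : ℕ → E}
    {K : ℝ} (h : ∀ᶠ j in atTop, ‖u j‖ ≤ K) : Bornology.IsBounded (Set.range u) := by
  have hb : IsBoundedUnder (· ≤ ·) atTop fun j => ‖u j‖ := ⟨K, by simpa using h⟩
  obtain ⟨C, hC⟩ := hb.bddAbove_range
  exact isBounded_iff_forall_norm_le.mpr
    ⟨C, by rintro _ ⟨j, rfl⟩; exact hC ⟨j, rfl⟩⟩

/-- Along bounded admissible points with small residual `e`, the multiplier `w̃ = ∇h(A x)` is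
bounded. Testing convexity of `h` on a ball around `A x₀`, with `x₀` admissible, controls `‖w̃‖` by
`⟨A (x - x₀), w̃⟩` and a bounded quantity; `A* w̃` differs from `-s̃` by a bounded vector, and `s̃` is
a subgradient of `p` at `x - e`. The only unbounded term left is `⟨A e, w̃⟩`. -/
lemma exists_norm_wt_le (hF : P.FD2.Nonempty) (σ : ℝ) (y : Y) {x₀ : X} (hx₀ : P.Admissible x₀)
    {S : Set (X × X × Y)} (hS : Bornology.IsBounded S) :
    ∃ κ > 0, ∃ K, ∀ x, P.Admissible x → (x, P.ek σ y x, P.yt σ y x) ∈ S →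
      ‖P.A (P.ek σ y x)‖ ≤ κ → ‖P.wt x‖ ≤ K := by
  obtain ⟨zb, hzb⟩ := hF
  obtain ⟨⟨hwb, -, hsb⟩, -⟩ := mem_FD2_iff.mp hzb
  have hd : DifferentiableAt ℝ (fun v => (P.h v).toReal) (P.A x₀) :=
    P.h_smooth.differentiableOn.differentiableAt (isOpen_interior.mem_nhds hx₀.2)
  have hnhds : ∀ᶠ v in 𝓝 (P.A x₀), v ∈ effDom P.h ∧
      (P.h v).toReal < (P.h (P.A x₀)).toReal + 1 :=
    Filter.Eventually.and (mem_interior_iff_mem_nhds.mp hx₀.2)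
      (hd.continuousAt.eventually_lt continuousAt_const (by linarith))
  obtain ⟨r', hr', hball⟩ := Metric.eventually_nhds_iff_ball.mp hnhds
  obtain ⟨r, hr, hrr'⟩ : ∃ r > 0, r < r' := ⟨r' / 2, by positivity, by linarith⟩
  have hA : Continuous P.A := P.A.continuous_of_finiteDimensional
  have hB : Continuous P.B := P.B.continuous_of_finiteDimensional
  let Φ : X × X × Y → ℝ := fun q =>
    (P.h (P.A x₀)).toReal + 1 + (conj P.h zb.fst).toReal - inner ℝ (P.A q.1) zb.fst +
      inner ℝ (q.1 - x₀) (q.2.1 - P.c) - inner ℝ (P.B (q.1 - x₀)) q.2.2 +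
      (P.p x₀).toReal - inner ℝ (q.1 - q.2.1) zb.snd.snd + (conj P.p zb.snd.snd).toReal -
      inner ℝ q.2.1 (q.2.1 - P.c) + inner ℝ (P.B q.2.1) q.2.2
  have hΦ : Continuous Φ := by fun_prop
  obtain ⟨C, hC⟩ := (isBounded_image_of_continuous hΦ hS).bddAbove
  refine ⟨r / 2, by positivity, 2 * C / r, fun x hx hxS hAe => ?_⟩
  have hΦC : Φ (x, P.ek σ y x, P.yt σ y x) ≤ C := hC ⟨_, hxS, rfl⟩
  obtain ⟨hw, hweq⟩ := wt_spec hx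
  obtain ⟨hs, hseq⟩ := st_spec ⟨zb, hzb⟩ σ y x
  have hres := resid_zt ⟨zb, hzb⟩ σ y x
  change LinearMap.adjoint P.A (P.wt x) + LinearMap.adjoint P.B (P.yt σ y x) + P.st σ y x + P.c =
    P.ek σ y x at hres
  have hemem := sub_ek_mem ⟨zb, hzb⟩ σ y x
  set e := P.ek σ y x
  set w := P.wt x
  set v := P.yt σ y x
  set s := P.st σ y x
  have h1 : (inner ℝ (P.A x₀) w : ℝ) + r * ‖w‖ ≤
      (P.h (P.A x₀)).toReal + 1 + (conj P.h w).toReal := by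
    have hmem : P.A x₀ + (r / ‖w‖) • w ∈ Metric.ball (P.A x₀) r' := by
      rw [mem_ball_iff_norm, add_sub_cancel_left, norm_smul, Real.norm_of_nonneg (by positivity)]
      refine lt_of_le_of_lt ?_ hrr'
      rw [div_mul_eq_mul_div]
      exact div_le_of_le_mul₀ (norm_nonneg _) hr.le le_rfl
    obtain ⟨hm1, hm2⟩ := hball _ hmem
    have := inner_le_toReal_add_toReal_conj P.h_pcc.ne_bot hm1 hw
    rw [inner_add_left, real_inner_smul_left, real_inner_self_eq_norm_sq] at this
    have h2 : r / ‖w‖ * ‖w‖ ^ 2 = r * ‖w‖ := by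
      rcases eq_or_ne ‖w‖ 0 with h0 | h0
      · rw [h0]
        simp
      · field_simp
    linarith
  have h2 := inner_le_toReal_add_toReal_conj P.h_pcc.ne_bot (interior_subset hx.2) hwb
  have h3 := inner_le_toReal_add_toReal_conj P.p_pcc.ne_bot hx₀.1 hs
  have h4 := inner_le_toReal_add_toReal_conj P.p_pcc.ne_bot hemem hsb
  have h5 : ∀ u : X, (inner ℝ u s : ℝ) =
      inner ℝ u (e - P.c) - inner ℝ (P.A u) w - inner ℝ (P.B u) v := by
    intro u
    rw [← inner_adjoint_right, ← inner_adjoint_right, ← hres, ← inner_sub_right, ← inner_sub_right]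
    congr 1
    abel
  have h6 : (inner ℝ (P.A e) w : ℝ) ≤ r / 2 * ‖w‖ :=
    (real_inner_le_norm _ _).trans (mul_le_mul_of_nonneg_right hAe (norm_nonneg _))
  have h7 := h5 (x - x₀)
  have h8 := h5 e
  have h9 : (inner ℝ (P.A (x - x₀)) w : ℝ) = inner ℝ (P.A x) w - inner ℝ (P.A x₀) w := by
    rw [map_sub, inner_sub_left]
  simp only [inner_sub_left x x₀ s] at h7
  rw [inner_sub_left] at hseq
  have h10 : r / 2 * ‖w‖ ≤ C := by
    simp only [Φ] at hΦC
    linarith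
  rw [le_div_iff₀ hr]
  linarith

lemma isBounded_range_zt (hF : P.FD2.Nonempty) {x : ℕ → X} (hx : ∀ j, P.Admissible (x j))
    (hxb : Bornology.IsBounded (Set.range x))
    (he : Tendsto (fun j => ‖P.ek σ y (x j)‖) atTop (𝓝 0)) :
    Bornology.IsBounded (Set.range fun j => P.zt σ y (x j)) := by
  have : CompleteSpace Y := FiniteDimensional.complete ℝ Y
  have he0 : Tendsto (fun j => P.ek σ y (x j)) atTop (𝓝 0) :=
    tendsto_zero_iff_norm_tendsto_zero.mpr he
  have heb : Bornology.IsBounded (Set.range fun j => P.ek σ y (x j)) :=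
    Metric.isBounded_range_of_tendsto _ he0
  have hA : Continuous P.A := P.A.continuous_of_finiteDimensional
  have hB : Continuous P.B := P.B.continuous_of_finiteDimensional
  have hA' : Continuous (LinearMap.adjoint P.A) := LinearMap.continuous_of_finiteDimensional _
  have hB' : Continuous (LinearMap.adjoint P.B) := LinearMap.continuous_of_finiteDimensional _
  have hyb : Bornology.IsBounded (Set.range fun j => P.yt σ y (x j)) := by
    obtain ⟨C, hC⟩ := isBounded_iff_forall_norm_le.mp
      (isBounded_range_comp (φ := fun u => y + σ • (P.B u - P.b)) (by fun_prop) hxb)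
    refine isBounded_iff_forall_norm_le.mpr ⟨C, ?_⟩
    rintro _ ⟨j, rfl⟩
    exact (norm_proj_polar_le _ _).trans (hC _ ⟨j, rfl⟩)
  obtain ⟨κ, hκ, K, hK⟩ := exists_norm_wt_le hF σ y (hx 0)
    (isBounded_range_prodMk hxb (isBounded_range_prodMk heb hyb))
  have hwb : Bornology.IsBounded (Set.range fun j => P.wt (x j)) := by
    refine isBounded_range_of_eventually_norm_le (K := K) ?_
    have hAe : Tendsto (fun j => ‖P.A (P.ek σ y (x j))‖) atTop (𝓝 0) := by
      simpa using ((hA.tendsto 0).comp he0).norm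
    filter_upwards [hAe.eventually_le_const hκ] with j hj
    exact hK _ (hx j) ⟨j, rfl⟩ hj
  have hφ : Continuous fun q : W × Y × X => mkDual q.1 q.2.1
      (q.2.2 - LinearMap.adjoint P.A q.1 - LinearMap.adjoint P.B q.2.1 - P.c) := by
    unfold mkDual
    fun_prop
  have := isBounded_range_comp hφ (isBounded_range_prodMk hwb (isBounded_range_prodMk hyb heb))
  have hzt : (fun j => P.zt σ y (x j)) = fun j => mkDual (P.wt (x j)) (P.yt σ y (x j))
      (P.ek σ y (x j) - LinearMap.adjoint P.A (P.wt (x j)) -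
        LinearMap.adjoint P.B (P.yt σ y (x j)) - P.c) := by
    funext j
    rw [← resid_zt hF σ y (x j)]
    change mkDual _ _ (P.st σ y (x j)) = mkDual _ _ (LinearMap.adjoint P.A (P.wt (x j)) +
      LinearMap.adjoint P.B (P.yt σ y (x j)) + P.st σ y (x j) + P.c - _ - _ - _)
    congr 1
    abel
  rw [hzt]
  exact this

/-- The subproblem objective is uniformly midpoint convex with respect to the multiplier `ỹ`. -/
lemma exists_midpoint_le (hσ : 0 < σ) (y : Y) {x₁ x₂ : X} (h₁ : x₁ ∈ P.primalDom)
    (h₂ : x₂ ∈ P.primalDom) : ∃ x ∈ P.primalDom,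
      P.fkReal σ y x + 1 / (8 * σ) * ‖P.yt σ y x₁ - P.yt σ y x₂‖ ^ 2 ≤
        (P.fkReal σ y x₁ + P.fkReal σ y x₂) / 2 := by
  have : CompleteSpace Y := FiniteDimensional.complete ℝ Y
  obtain ⟨hpd, hp⟩ := convexOn_toReal P.p_pcc
  obtain ⟨hhd, hh⟩ := convexOn_toReal P.h_pcc
  have ha : (0 : ℝ) ≤ 1 / 2 := by norm_num
  have hab : (1 / 2 : ℝ) + 1 / 2 = 1 := by norm_num
  have hA : P.A ((1 / 2 : ℝ) • x₁ + (1 / 2 : ℝ) • x₂) =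
      (1 / 2 : ℝ) • P.A x₁ + (1 / 2 : ℝ) • P.A x₂ := by simp only [map_add, map_smul]
  refine ⟨(1 / 2 : ℝ) • x₁ + (1 / 2 : ℝ) • x₂, ⟨hpd h₁.1 h₂.1 ha ha hab, ?_⟩, ?_⟩
  · rw [hA]
    exact hhd h₁.2 h₂.2 ha ha hab
  have e1 := hp h₁.1 h₂.1 ha ha hab
  have e2 := hh h₁.2 h₂.2 ha ha hab
  rw [← hA] at e2
  simp only [smul_eq_mul] at e1 e2
  have e3 := norm_proj_midpoint_sq_le (D := (P.Q : Set Y)) (y + σ • (P.B x₁ - P.b))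
    (y + σ • (P.B x₂ - P.b)) (y + σ • (P.B ((1 / 2 : ℝ) • x₁ + (1 / 2 : ℝ) • x₂) - P.b)) (by
      simp only [map_add, map_smul]
      module)
  change ‖P.yt σ y _‖ ^ 2 + ‖P.yt σ y x₁ - P.yt σ y x₂‖ ^ 2 / 4 ≤
    (‖P.yt σ y x₁‖ ^ 2 + ‖P.yt σ y x₂‖ ^ 2) / 2 at e3
  have e4 := mul_le_mul_of_nonneg_left e3 (show (0 : ℝ) ≤ 1 / (2 * σ) by positivity)
  have e5 : 1 / (8 * σ) * ‖P.yt σ y x₁ - P.yt σ y x₂‖ ^ 2 =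
      1 / (2 * σ) * (‖P.yt σ y x₁ - P.yt σ y x₂‖ ^ 2 / 4) := by
    field_simp
    ring
  rw [fkReal, fkReal, fkReal, e5, inner_add_right, inner_smul_right, inner_smul_right]
  linarith

lemma exists_tendsto_yt (hσ : 0 < σ) (y : Y) {x : ℕ → X} {m : ℝ} (hx : ∀ j, x j ∈ P.primalDom)
    (hm : ∀ u ∈ P.primalDom, m ≤ P.fkReal σ y u)
    (hlim : Tendsto (fun j => P.fkReal σ y (x j)) atTop (𝓝 m)) :
    ∃ yinf, Tendsto (fun j => P.yt σ y (x j)) atTop (𝓝 yinf) := by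
  have : CompleteSpace Y := FiniteDimensional.complete ℝ Y
  refine cauchySeq_tendsto_of_complete (Metric.cauchySeq_iff.mpr fun ε hε => ?_)
  have hev : ∀ᶠ j in atTop, P.fkReal σ y (x j) < m + ε ^ 2 / (8 * σ) :=
    hlim.eventually_lt_const (by
      have : 0 < ε ^ 2 / (8 * σ) := by positivity
      linarith)
  obtain ⟨N, hN⟩ := eventually_atTop.mp hev
  refine ⟨N, fun i hi j hj => ?_⟩
  obtain ⟨u, hu, hle⟩ := exists_midpoint_le hσ y (hx i) (hx j)
  have h1 := hm u hu
  have h2 := hN i hi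
  have h3 := hN j hj
  have h4 : 1 / (8 * σ) * ‖P.yt σ y (x i) - P.yt σ y (x j)‖ ^ 2 < 1 / (8 * σ) * ε ^ 2 := by
    rw [one_div_mul_eq_div _ (ε ^ 2)]
    linarith
  rw [dist_eq_norm]
  exact lt_of_pow_lt_pow_left₀ 2 hε.le (lt_of_mul_lt_mul_left h4 (by positivity))

/-- Along a sequence with bounded primal and dual candidates, a vanishing residual eventually obeys
every scaled bound whose numerator stays away from `0`. -/
lemma eventually_scaledBound (h1 : P.Assumption1 Lh) (hσ : 0 < σ) (y : Y) {x : ℕ → X}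
    (hx : ∀ j, P.Admissible (x j)) (hxb : Bornology.IsBounded (Set.range x))
    (hzb : Bornology.IsBounded (Set.range fun j => P.zt σ y (x j)))
    (he : Tendsto (fun j => ‖P.ek σ y (x j)‖) atTop (𝓝 0)) {t : ℕ → ℝ} {δ : ℝ} (hδ : 0 < δ)
    (ht : ∀ j, δ ≤ t j) : ∀ᶠ j in atTop, P.ScaledBound σ y (x j) (2 * t j) := by
  obtain ⟨R, hR⟩ := isBounded_iff_forall_norm_le.mp hxb
  obtain ⟨S, hS⟩ := isBounded_iff_forall_norm_le.mp hzb
  have hx' : ∀ j, ‖x j‖ ≤ R := fun j => hR _ ⟨j, rfl⟩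
  have hz' : ∀ j, ‖P.zt σ y (x j)‖ ≤ S := fun j => hS _ ⟨j, rfl⟩
  have hR0 : 0 ≤ R := (norm_nonneg _).trans (hx' 0)
  have hS0 : 0 ≤ S := (norm_nonneg _).trans (hz' 0)
  set G := ‖grad (conj P.h) (P.wt (x 0))‖ + Lh * (S + S) with hG
  have hG0 : 0 ≤ G := by positivity
  have hgrad : ∀ j, ‖grad (conj P.h) (P.wt (x j))‖ ≤ G := by
    intro j
    have h := h1.lipschitz.dist_le_mul _ (wt_spec (hx j)).1 _ (wt_spec (hx 0)).1
    rw [dist_eq_norm, dist_eq_norm] at h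
    have hw : ∀ i, ‖P.wt (x i)‖ ≤ S := fun i =>
      (WithLp.norm_fst_le _ (P.zt σ y (x i))).trans (hz' i)
    have h2 : ‖P.wt (x j) - P.wt (x 0)‖ ≤ S + S :=
      (norm_sub_le _ _).trans (add_le_add (hw j) (hw 0))
    have h3 := norm_le_norm_add_norm_sub' (grad (conj P.h) (P.wt (x j)))
      (grad (conj P.h) (P.wt (x 0)))
    have h4 := mul_le_mul_of_nonneg_left h2 Lh.2
    change (Lh : ℝ) * _ ≤ Lh * _ at h4
    linarith
  have hyt : ∀ j, ‖P.yt σ y (x j) - y‖ / σ ≤ (S + ‖y‖) / σ := by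
    intro j
    have := (norm_snd_fst_le (P.zt σ y (x j))).trans (hz' j)
    gcongr
    exact (norm_sub_le _ _).trans (add_le_add this le_rfl)
  have hpos : 0 < 2 * δ / (1 + R + S) * min (1 / (G + (S + ‖y‖) / σ + 1 / σ)) 1 := by positivity
  filter_upwards [he.eventually_le_const hpos] with j hj
  rw [ScaledBound]
  refine hj.trans ?_
  have i1 := hx' j
  have i2 := hz' j
  have i3 := hgrad j
  have i4 := hyt j
  have i5 := ht j
  have i6 : 0 ≤ t j := hδ.le.trans i5
  gcongr

/-! ### The outer iteration -/

/-- A quantitative form of the nonexpansiveness of the proximal point step on the dual: a nearly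
optimal dual feasible point of the subproblem centred at `y` is, up to the accuracy, no farther
from a dual solution than `y`. -/
lemma norm_sub_dual_solution_le (hσ : 0 < σ) (hx : x ∈ P.primalDom) {zb z : DualSpace W X Y}
    (hzb : zb ∈ P.SOLD2) (hz : z ∈ P.FD2) {δ ε : ℝ} (hε : 0 < ε)
    (hle : P.fkReal σ y x ≤ P.gkReal σ y z + δ) (hδ : 2 * σ * δ ≤ ε ^ 2) :
    ‖z.snd.fst - zb.snd.fst‖ ≤ ‖y - zb.snd.fst‖ + 2 * ε := by
  obtain ⟨hzd, hz0⟩ := mem_FD2_iff.mp hz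
  obtain ⟨hzbd, hzb0⟩ := mem_FD2_iff.mp hzb.1
  set a := ‖z.snd.fst - zb.snd.fst‖ with ha
  set D := ‖y - zb.snd.fst‖ with hD
  have hD0 : 0 ≤ D := norm_nonneg _
  rcases le_or_gt a ε with hae | hae
  · linarith
  have ha0 : 0 < a := hε.trans hae
  -- this weight makes both error terms equal to `ε a`
  obtain ⟨θ, hθa⟩ : ∃ θ, θ * a = ε := ⟨ε / a, div_mul_cancel₀ _ ha0.ne'⟩
  have hθ0 : 0 < θ := pos_of_mul_pos_left (hθa ▸ hε) ha0.le
  have hθ1 : θ < 1 := by nlinarith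
  have hmem : (1 - θ) • z + θ • zb ∈ P.FD2 := by
    refine mem_FD2_iff.mpr ⟨convex_dualDom P hzd hzbd (by linarith) hθ0.le (by ring), ?_⟩
    rw [resid_combo (by ring), hz0, hzb0, smul_zero, smul_zero, add_zero]
  have h1 := gkReal_le_fkReal (y := y) hσ hx hmem
  have h2 := gkReal_combo_ge σ y hzd hzbd (a := 1 - θ) (b := θ) (by linarith) hθ0.le (by ring)
  have h3 : P.g0Real z ≤ P.g0Real zb := by
    have := hzb.2 z hz
    rwa [g0_eq_coe hzd, g0_eq_coe hzbd, EReal.coe_le_coe_iff] at this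
  have h4 : P.gkReal σ y z - 1 / (2 * σ) * D ^ 2 ≤ P.gkReal σ y zb := by
    rw [gkReal, gkReal, hD, norm_sub_rev y]
    have : 0 ≤ 1 / (2 * σ) * ‖z.snd.fst - y‖ ^ 2 := by positivity
    linarith
  have h5 : 1 / (2 * σ) * ((1 - θ) * θ * a ^ 2) - θ * (1 / (2 * σ) * D ^ 2) ≤ δ := by
    have := mul_le_mul_of_nonneg_left h4 hθ0.le
    linarith
  have h6 : (1 - θ) * θ * a ^ 2 - θ * D ^ 2 ≤ ε ^ 2 := by
    have h := mul_le_mul_of_nonneg_left h5 (show 0 ≤ 2 * σ by positivity)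
    have e : 2 * σ * (1 / (2 * σ) * ((1 - θ) * θ * a ^ 2) - θ * (1 / (2 * σ) * D ^ 2)) =
        (1 - θ) * θ * a ^ 2 - θ * D ^ 2 := by field_simp
    linarith
  have h7 : θ * ((1 - θ) * a ^ 2 - D ^ 2) ≤ θ * (ε * a) := by
    have : θ * (ε * a) = ε ^ 2 := by rw [mul_left_comm, hθa, sq]
    linarith
  have h8 : (1 - θ) * a ^ 2 - D ^ 2 ≤ ε * a := le_of_mul_le_mul_left h7 hθ0
  have h9 : θ * a ^ 2 = ε * a := by rw [sq, ← mul_assoc, hθa]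
  have h10 : (a - ε) ^ 2 ≤ (D + ε) ^ 2 := by nlinarith
  have := le_of_sq_le_sq h10 (by positivity)
  linarith

lemma exists_le_of_eventually_le_add {D a : ℕ → ℝ} (ha : ∀ k, 0 ≤ a k) (hs : Summable a)
    (h : ∀ᶠ k in atTop, D (k + 1) ≤ D k + a k) : ∃ K, ∀ k, D k ≤ K := by
  obtain ⟨N, hN⟩ := eventually_atTop.mp h
  have key : ∀ n, D (N + n) ≤ D N + ∑ i ∈ Finset.range n, a (N + i) := by
    intro n
    induction n with
    | zero => simp
    | succ n ih =>
      rw [Finset.sum_range_succ, ← add_assoc N n 1]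
      linarith [hN (N + n) (by omega)]
  have hs' : Summable fun i => a (N + i) := by
    simpa [add_comm N] using (summable_nat_add_iff N).mpr hs
  have hb : IsBoundedUnder (· ≤ ·) atTop D := by
    refine ⟨D N + ∑' i, a (N + i), ?_⟩
    rw [eventually_map]
    filter_upwards [eventually_ge_atTop N] with k hk
    obtain ⟨n, rfl⟩ := Nat.exists_eq_add_of_le hk
    have := hs'.sum_le_tsum (Finset.range n) fun i _ => ha _
    linarith [key n]
  obtain ⟨K, hK⟩ := hb.bddAbove_range
  exact ⟨K, fun k => hK ⟨k, rfl⟩⟩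

lemma eventually_sq_mul_le {ε : ℕ → ℝ} (hε : Tendsto ε atTop (𝓝 0)) (C : ℝ) :
    ∀ᶠ k in atTop, ε k ^ 2 * C ≤ 1 := by
  have : Tendsto (fun k => ε k ^ 2 * C) atTop (𝓝 0) := by
    simpa using (hε.pow 2).mul_const C
  exact this.eventually_le_const one_pos

lemma IsALMSequence.eventually_sq_div_le {σ : ℕ → ℝ} {x : ℕ → X} {y : ℕ → Y}
    (hs : P.IsALMSequence σ x y) {ε : ℕ → ℝ} (hε : Tendsto ε atTop (𝓝 0)) :
    ∀ᶠ k in atTop, ε k ^ 2 / (2 * σ k) ≤ 1 := by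
  filter_upwards [eventually_sq_mul_le hε (1 / (2 * σ 0))] with k hk
  have h0 := hs.sigma_pos 0
  have h1 := hs.sigma_mono (Nat.zero_le k)
  refine le_trans ?_ hk
  rw [mul_one_div]
  gcongr

/-- The dual iterates of the augmented Lagrangian method are bounded under the implementable
criterion with summable tolerances. -/
lemma exists_norm_sub_le (h1 : P.Assumption1 Lh)
    (hp : LipschitzOnWith Lp (fun x => (P.p x).toReal) (effDom P.p))
    (hps : LipschitzOnWith Lps (fun s => (conj P.p s).toReal) (effDom (conj P.p)))
    {zb : DualSpace W X Y} (hzb : zb ∈ P.SOLD2) {γ : ℝ} (hγ : P.IsErrorBound γ) {σ : ℕ → ℝ}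
    {x : ℕ → X} {y : ℕ → Y} (hs : P.IsALMSequence σ x y) {ε : ℕ → ℝ} (hε : ∀ k, 0 < ε k)
    (hsum : Summable ε) (hA : ∀ k, P.CritA'' (σ k) (y k) (x (k + 1)) (ε k)) :
    ∃ K, ∀ k, ‖y k - zb.snd.fst‖ ≤ K := by
  have hγ1 : 1 ≤ γ := hγ.1
  have hσ0 := hs.sigma_pos 0
  have hβ0 : 0 ≤ P.beta Lh Lp Lps γ := Real.sqrt_nonneg _
  set β := P.beta Lh Lp Lps γ with hβ
  set c := 2 * (β + 1) + (2 * γ + 1) / (2 * σ 0) with hc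
  have hc0 : 0 ≤ c := by positivity
  refine exists_le_of_eventually_le_add (a := fun k => c * ε k)
    (fun k => mul_nonneg hc0 (hε k).le) (hsum.mul_left c) ?_
  filter_upwards [hs.eventually_sq_div_le hsum.tendsto_atTop_zero,
    hsum.tendsto_atTop_zero.eventually_le_const one_pos] with k hk1 hk2
  have hσ := hs.sigma_pos k
  have hεk := hε k
  have hx := hs.admissible k
  set t := ε k ^ 2 / (2 * σ k) with ht
  have ht0 : 0 < t := by positivity
  have hS : P.ScaledBound (σ k) (y k) (x (k + 1)) (2 * t) := by
    have := hA k
    rw [CritA''] at this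
    convert this using 1
    rw [ht]
    field_simp
  obtain ⟨z, hz, hle, hdist⟩ := exists_feasible_of_scaledBound h1 hp hps ⟨zb, hzb.1⟩ hγ hσ hx
    ht0.le hk1 hS ht0
  have hacc : 2 * σ k * (β ^ 2 * t + t) ≤ ((β + 1) * ε k) ^ 2 := by
    have e : 2 * σ k * (β ^ 2 * t + t) = (β ^ 2 + 1) * ε k ^ 2 := by
      rw [ht]
      field_simp
    rw [e, mul_pow]
    gcongr
    nlinarith
  have hstep := norm_sub_dual_solution_le hσ hx.mem_primalDom hzb hz (ε := (β + 1) * ε k)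
    (by positivity) (by rw [← add_assoc]; exact hle) hacc
  rw [← hs.update k] at hdist
  have htle : t ≤ ε k / (2 * σ 0) := by
    have h1 := hs.sigma_mono (Nat.zero_le k)
    have h2 : ε k ^ 2 ≤ ε k := by nlinarith
    rw [ht]
    gcongr
  have htri : ‖y (k + 1) - zb.snd.fst‖ ≤ ‖z.snd.fst - y (k + 1)‖ + ‖z.snd.fst - zb.snd.fst‖ := by
    rw [norm_sub_rev z.snd.fst (y (k + 1))]
    exact norm_sub_le_norm_sub_add_norm_sub _ _ _
  have h3 : (2 * γ + 1) * t ≤ (2 * γ + 1) * (ε k / (2 * σ 0)) := by gcongr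
  have h4 : c * ε k = 2 * ((β + 1) * ε k) + (2 * γ + 1) * (ε k / (2 * σ 0)) := by
    rw [hc]
    ring
  change _ ≤ _ + c * ε k
  linarith

lemma exists_summable_critA' (h1 : P.Assumption1 Lh)
    (hp : LipschitzOnWith Lp (fun x => (P.p x).toReal) (effDom P.p))
    (hps : LipschitzOnWith Lps (fun s => (conj P.p s).toReal) (effDom (conj P.p)))
    (hF : P.FD2.Nonempty) {γ : ℝ} (hγ : P.IsErrorBound γ) {σ : ℕ → ℝ}
    {x : ℕ → X} {y : ℕ → Y} (hs : P.IsALMSequence σ x y) {ε : ℕ → ℝ} (hε : ∀ k, 0 < ε k)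
    (hsum : Summable ε) (hA : ∀ k, P.CritA'' (σ k) (y k) (x (k + 1)) (ε k)) :
    ∃ ε' : ℕ → ℝ, (∀ k, 0 ≤ ε' k) ∧ Summable ε' ∧
      (∀ᶠ k in atTop, ε' k = P.beta Lh Lp Lps γ * ε k) ∧
      ∀ k, P.CritA' (σ k) (y k) (x (k + 1)) (ε' k) := by
  have hex : ∀ k, ∃ e, 0 ≤ e ∧ P.CritA' (σ k) (y k) (x (k + 1)) e ∧
      (ε k ^ 2 / (2 * σ k) ≤ 1 → e = P.beta Lh Lp Lps γ * ε k) := by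
    intro k
    have hσ := hs.sigma_pos k
    have hx := hs.admissible k
    by_cases hk : ε k ^ 2 / (2 * σ k) ≤ 1
    · exact ⟨_, mul_nonneg (Real.sqrt_nonneg _) (hε k).le,
        critA'_of_critA'' h1 hp hps hF hγ hσ hx hk (hA k), fun _ => rfl⟩
    -- at the finitely many other iterations the actual gap, a real number, is used
    · obtain ⟨m, hm, hmle, -⟩ := exists_iInf_eq_coe (y := y k) hσ hF hx.mem_primalDom
      have h0 : 0 ≤ P.fkReal (σ k) (y k) (x (k + 1)) - m :=
        sub_nonneg.mpr (hmle _ hx.mem_primalDom)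
      refine ⟨√(2 * σ k * (P.fkReal (σ k) (y k) (x (k + 1)) - m)), Real.sqrt_nonneg _, ?_,
        fun h => absurd h hk⟩
      rw [CritA', GapLe, hm, fk_eq_coe hx.mem_primalDom, ← EReal.coe_add, EReal.coe_le_coe_iff,
        Real.sq_sqrt (by positivity)]
      rw [mul_div_cancel_left₀ _ (by positivity)]
      linarith
  choose ε' h0 hcrit heq using hex
  have hev : ∀ᶠ k in atTop, ε' k = P.beta Lh Lp Lps γ * ε k :=
    (hs.eventually_sq_div_le hsum.tendsto_atTop_zero).mono fun k hk => heq k hk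
  exact ⟨ε', h0, (summable_congr_atTop hev).mpr (hsum.mul_left _), hev, hcrit⟩

lemma eventually_critB' (h1 : P.Assumption1 Lh)
    (hp : LipschitzOnWith Lp (fun x => (P.p x).toReal) (effDom P.p))
    (hps : LipschitzOnWith Lps (fun s => (conj P.p s).toReal) (effDom (conj P.p)))
    {zb : DualSpace W X Y} (hzb : zb ∈ P.SOLD2) {γ : ℝ} (hγ : P.IsErrorBound γ) {σ : ℕ → ℝ}
    {x : ℕ → X} {y : ℕ → Y} (hs : P.IsALMSequence σ x y) {ε : ℕ → ℝ} (hε : ∀ k, 0 < ε k)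
    (hsum : Summable ε) (hA : ∀ k, P.CritA'' (σ k) (y k) (x (k + 1)) (ε k)) {η : ℕ → ℝ}
    (hη : Summable η) (hB : ∀ k, P.CritB'' (σ k) (y k) (x (k + 1)) (η k)) :
    ∀ᶠ k in atTop, P.beta Lh Lp Lps γ * η k < 1 ∧
      P.CritB' (σ k) (y k) (x (k + 1)) (P.beta Lh Lp Lps γ * η k) := by
  obtain ⟨K, hK⟩ := exists_norm_sub_le h1 hp hps hzb hγ hs hε hsum hA
  have hlim : Tendsto (fun k => P.beta Lh Lp Lps γ * η k) atTop (𝓝 0) := by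
    simpa using hη.tendsto_atTop_zero.const_mul (P.beta Lh Lp Lps γ)
  filter_upwards [hlim.eventually_lt_const one_pos,
    eventually_sq_mul_le hη.tendsto_atTop_zero (1 / (2 * σ 0) * (K + K) ^ 2)] with k hk1 hk2
  have hσ0 := hs.sigma_pos 0
  have hσ := hs.sigma_mono (Nat.zero_le k)
  refine ⟨hk1, critB'_of_critB'' h1 hp hps ⟨zb, hzb.1⟩ hγ (hs.sigma_pos k) (hs.admissible k)
    (le_trans ?_ hk2) (hB k)⟩
  have hy : ‖P.yt (σ k) (y k) (x (k + 1)) - y k‖ ≤ K + K := by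
    rw [← hs.update k, ← sub_sub_sub_cancel_right _ _ zb.snd.fst]
    exact (norm_sub_le _ _).trans (add_le_add (hK _) (hK _))
  rw [← mul_assoc, mul_one_div]
  gcongr

end CCCP

end

end ALM

theorem proposition7 {W X₁ X₂ Y₁ Y₂ : Type*}
    [NormedAddCommGroup W] [InnerProductSpace ℝ W] [FiniteDimensional ℝ W]
    [NormedAddCommGroup X₁] [InnerProductSpace ℝ X₁] [FiniteDimensional ℝ X₁]
    [NormedAddCommGroup X₂] [InnerProductSpace ℝ X₂] [FiniteDimensional ℝ X₂]
    [NormedAddCommGroup Y₁] [InnerProductSpace ℝ Y₁] [FiniteDimensional ℝ Y₁]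
    [NormedAddCommGroup Y₂] [InnerProductSpace ℝ Y₂] [FiniteDimensional ℝ Y₂]
    (P : ALM.CCCP W (WithLp 2 (X₁ × X₂)) (WithLp 2 (Y₁ × Y₂)))
    (Lh Lp Lps : ℝ≥0)
    (h1 : P.Assumption1 Lh) (h2 : P.Assumption2 Lp Lps) (h3 : P.Assumption3) :
    -- the constant of the dual error bound exists
    (∃ γ, P.IsErrorBound γ) ∧
    -- one subproblem, solved by an inner sequence
    (∀ (σ : ℝ) (y : WithLp 2 (Y₁ × Y₂)) (x : ℕ → WithLp 2 (X₁ × X₂)),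
      0 < σ → (∀ j, P.Admissible (x j)) →
      Tendsto (fun j => P.fk σ y (x j)) atTop (𝓝 (⨅ u, P.fk σ y u)) →
      Tendsto (fun j => ‖P.ek σ y (x j)‖) atTop (𝓝 0) →
        Bornology.IsBounded (Set.range x) ∧
        Bornology.IsBounded (Set.range fun j => P.zt σ y (x j)) ∧
        (∃ yinf, Tendsto (fun j => P.yt σ y (x j)) atTop (𝓝 yinf)) ∧
        (∀ j, P.fk σ y (x j) ≤ P.gk σ y (P.zt σ y (x j)) +
          (((‖x j‖ + ‖P.st σ y (x j)‖ + (Lp : ℝ)) * ‖P.ek σ y (x j)‖ : ℝ) : EReal)) ∧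
        ∀ t : ℕ → ℝ, (∀ j, t j ≤ 1) → (∃ δ > 0, ∀ j, δ ≤ t j) →
          ∃ j₀, ∀ j ≥ j₀, P.ScaledBound σ y (x j) (2 * t j) ∧
            ∀ γ, P.IsErrorBound γ → P.GapLe σ y (x j) (P.beta Lh Lp Lps γ ^ 2 * t j)) ∧
    -- the scaled bound on the residual alone controls the gap
    (∀ (γ σ : ℝ) (y : WithLp 2 (Y₁ × Y₂)) (x : WithLp 2 (X₁ × X₂)) (t : ℝ),
      P.IsErrorBound γ → 0 < σ → P.Admissible x → 0 ≤ t → t ≤ 1 →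
      P.ScaledBound σ y x (2 * t) → P.GapLe σ y x (P.beta Lh Lp Lps γ ^ 2 * t)) ∧
    -- the criteria at one iteration
    (∀ (γ σ : ℝ) (y : WithLp 2 (Y₁ × Y₂)) (x : WithLp 2 (X₁ × X₂)),
      P.IsErrorBound γ → 0 < σ → P.Admissible x →
      (∀ ε > 0, ε ^ 2 / (2 * σ) ≤ 1 →
        P.CritA'' σ y x ε → P.CritA' σ y x (P.beta Lh Lp Lps γ * ε)) ∧
      (∀ η > 0, η ^ 2 / (2 * σ) * ‖P.yt σ y x - y‖ ^ 2 ≤ 1 →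
        P.CritB'' σ y x η → P.CritB' σ y x (P.beta Lh Lp Lps γ * η))) ∧
    -- the criteria along the whole method
    (∀ (γ : ℝ) (σ : ℕ → ℝ) (x : ℕ → WithLp 2 (X₁ × X₂)) (y : ℕ → WithLp 2 (Y₁ × Y₂)) (ε : ℕ → ℝ),
      P.IsErrorBound γ → P.IsALMSequence σ x y → (∀ k, 0 < ε k) → Summable ε →
      (∀ k, P.CritA'' (σ k) (y k) (x (k + 1)) (ε k)) →
        (∃ ε' : ℕ → ℝ, (∀ k, 0 ≤ ε' k) ∧ Summable ε' ∧
          (∀ᶠ k in atTop, ε' k = P.beta Lh Lp Lps γ * ε k) ∧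
          ∀ k, P.CritA' (σ k) (y k) (x (k + 1)) (ε' k)) ∧
        ∀ η : ℕ → ℝ, (∀ k, 0 < η k) → Summable η →
          (∀ k, P.CritB'' (σ k) (y k) (x (k + 1)) (η k)) →
          ∃ k₀, ∀ k ≥ k₀, P.beta Lh Lp Lps γ * η k < 1 ∧
            P.CritB' (σ k) (y k) (x (k + 1)) (P.beta Lh Lp Lps γ * η k)) := by
  obtain ⟨zb, hzb, hR⟩ := h3
  have hp := h2.lipschitz
  have hps := h2.lipschitz_conj
  have hF : P.FD2.Nonempty := ⟨zb, hzb.1⟩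
  refine ⟨ALM.CCCP.exists_isErrorBound h1.isOpen hzb.1 hR, ?_, ?_, ?_, ?_⟩
  · intro σ y x hσ hx hlim he
    have hxd := fun j => (hx j).mem_primalDom
    obtain ⟨m, hm, hmle, -⟩ := ALM.CCCP.exists_iInf_eq_coe (y := y) hσ hF (hxd 0)
    have hlim' : Tendsto (fun j => P.fkReal σ y (x j)) atTop (𝓝 m) := by
      rw [hm] at hlim
      simp only [ALM.CCCP.fk_eq_coe (hxd _)] at hlim
      exact EReal.tendsto_coe.mp hlim
    have hxb : Bornology.IsBounded (Set.range x) := by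
      obtain ⟨ρ, hρ, C, hC⟩ := ALM.CCCP.exists_mul_norm_le_fkReal h1.isOpen hzb.1 hR hσ y
      obtain ⟨S, hS⟩ := hlim'.bddAbove_range
      refine isBounded_iff_forall_norm_le.mpr ⟨(S + C) / ρ, ?_⟩
      rintro _ ⟨j, rfl⟩
      rw [le_div_iff₀' hρ]
      linarith [hC _ (hxd j), hS ⟨j, rfl⟩]
    have hzbd := ALM.CCCP.isBounded_range_zt hF hx hxb he
    refine ⟨hxb, hzbd, ALM.CCCP.exists_tendsto_yt hσ y hxd hmle hlim', fun j => ?_, ?_⟩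
    · rw [ALM.CCCP.fk_eq_coe (hxd j),
        ALM.CCCP.gk_eq_coe (ALM.CCCP.zt_mem_dualDom hF σ y (hx j)), ← EReal.coe_add,
        EReal.coe_le_coe_iff]
      exact ALM.CCCP.fkReal_le_gkReal_zt hp hF hσ y (hx j)
    · rintro t ht1 ⟨δ, hδ, hδt⟩
      obtain ⟨j₀, hj₀⟩ := eventually_atTop.mp
        (ALM.CCCP.eventually_scaledBound h1 hσ y hx hxb hzbd he hδ hδt)
      exact ⟨j₀, fun j hj => ⟨hj₀ j hj, fun γ hγ => ALM.CCCP.gapLe_of_scaledBound h1 hp hps hF hγ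
        hσ (hx j) (hδ.le.trans (hδt j)) (ht1 j) (hj₀ j hj)⟩⟩
  · intro γ σ y x t hγ hσ hx ht0 ht1 hS
    exact ALM.CCCP.gapLe_of_scaledBound h1 hp hps hF hγ hσ hx ht0 ht1 hS
  · intro γ σ y x hγ hσ hx
    exact ⟨fun ε _ hle hA => ALM.CCCP.critA'_of_critA'' h1 hp hps hF hγ hσ hx hle hA,
      fun η _ hle hB => ALM.CCCP.critB'_of_critB'' h1 hp hps hF hγ hσ hx hle hB⟩
  · intro γ σ x y ε hγ hs hε hsum hA
    refine ⟨ALM.CCCP.exists_summable_critA' h1 hp hps hF hγ hs hε hsum hA, ?_⟩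
    intro η _ hη hB
    exact eventually_atTop.mp
      (ALM.CCCP.eventually_critB' h1 hp hps hzb hγ hs hε hsum hA hη hB)
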